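/- Let $N$ be a natural number, $\mathfrak{her}(N)$ the real vector space of Hermitian complex $N\times N$ matrices, and $GL(\mathfrak{her}(N))$ the Lie group of invertible real-linear operators on it, with Lie algebra $\mathfrak{gl}(\mathfrak{her}(N))$. All closures below are taken in $GL(\mathfrak{her}(N))$. Let $\mathbf P^{\rm cp}$ be the semigroup of all $T\in GL(\mathfrak{her}(N))$ such that $T$ and all $T\otimes 1_m$, $m\in\mathbb N$, map density matrices to density matrices (the invertible quantum channels), and let $\mathbf P^{\rm cp}_0$ be the connected component of the identity in $\mathbf P^{\rm cp}$. For $\mathbf S\subseteq GL(\mathfrak{her}(N))$ the tangent cone is $$\mathrm L(\mathbf S)=\{\dot\gamma(0)\mid \gamma:[0,\infty)\to GL(\mathfrak{her}(N))\text{ smooth},\ \gamma(0)=\mathrm{id},\ \gamma(t)\in\mathbf S\text{ for all }t\ge 0\}.$$ A set $\mathfrak w\subseteq\mathfrak{gl}(\mathfrak{her}(N))$ is a Lie wedge if it is a closed convex cone containing $0$ with $e^{g}\mathfrak w e^{-g}=\mathfrak w$ for all $g\in\mathfrak w\cap(-\mathfrak w)$. A Lie subsemigroup is a closed subset $\mathbf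 S\subseteq GL(\mathfrak{her}(N))$ that contains $\mathrm{id}$, is closed under multiplication and satisfies $\mathbf S=\overline{\langle\exp \mathrm L(\mathbf S)\rangle}_S$, where $\langle\cdot\rangle_S$ denotes the generated semigroup. Put $$\mathbf T:=\overline{\langle \exp \mathrm L(\mathbf P^{\rm cp}_0)\rangle}_S .$$ A Kossakowski–Lindblad generator is an operator $-\mathcal L$ on $\mathfrak{her}(N)$ with $$\mathcal L(\rho)=i[H,\rho]+\tfrac12\sum_k\big(V_k^\dagger V_k\rho+\rho V_k^\dagger V_k-2V_k\rho V_k^\dagger\big)$$ for some $H\in\mathfrak{her}(N)$ and finitely many complex $N\times N$ matrices $V_k$. A time dependent Markovian channel is the value $X(\tau)$, for some $\tau\ge 0$, of a solution of $\dot X=-\mathcal L(t)\circ X$, $X(0)=\mathrm{id}$ on $[0,\tau]$, where every $-\mathcal L(t)$ is a Kossakowski–Lindblad generator; here $t\mapsto \mathcal L(t)$ is integrable on $[0,\tau]$ and $X$ is continuous and satisfies the integrated equation $X(t)=\mathrm{id}-\int_0^t\mathcal L(s)\circ X(s)\,ds$. Then: 1. The closure of the set of all time dependent Markovian channels equals $\mathbf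 T$. The same holds for the closure of the subset of those obtained from continuous $t\mapsto\mathcal L(t)$ and classical ($C^1$) solutions $X$. 2. $\mathbf T$ is a Lie subsemigroup, and $\mathbf T\subseteq\mathbf P^{\rm cp}_0$. 3. The tangent cone of $\mathbf T$ at the identity is $\mathrm L(\mathbf T)=\mathrm L(\mathbf P^{\rm cp}_0)$; this set is a Lie wedge, and it is exactly the set of all Kossakowski–Lindblad generators. -/

import Mathlib

open scoped Matrix.Norms.L2Operator Matrix

noncomputable section

namespace MarkovLie

/-! ### Hermitian matrices, superoperators and the group `GL(her(N))` -/

/-- `her(N)`: the real vector space of Hermitian complex `N × N` matrices. (Its norm is the spectral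
norm; only the topology, which does not depend on the norm, matters below.) -/
abbrev Her (N : ℕ) : Submodule ℝ (Matrix (Fin N) (Fin N) ℂ) :=
  selfAdjoint.submodule ℝ (Matrix (Fin N) (Fin N) ℂ)

/-- The Lie algebra `gl(her(N))` of all real linear operators on `her(N)`. -/
abbrev Op (N : ℕ) : Type := Her N →L[ℝ] Her N

instance instNormedRingOp (N : ℕ) : NormedRing (Op N) := inferInstance

instance instNormedAlgebraOp (N : ℕ) : NormedAlgebra ℝ (Op N) := inferInstance

instance instCompleteSpaceOp (N : ℕ) : CompleteSpace (Op N) := inferInstance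

/-- The Lie group `GL(her(N))`: the invertible elements of `gl(her(N))`, with the topology of the
unit group. -/
abbrev GLHer (N : ℕ) : Type := (Op N)ˣ

/-! ### Subsemigroups of `GL(her(N))`, tangent cones, Lie wedges, Lie subsemigroups -/

/-- The tangent cone `L(S)` at the identity: all initial velocities `γ'(0)` of smooth curves
`γ : [0, ∞) → GL(her(N))` with `γ 0 = 1` and `γ t ∈ S` for all `t ≥ 0`. -/
def tangentCone {N : ℕ} (S : Set (GLHer N)) : Set (Op N) :=
  {g | ∃ γ : ℝ → GLHer N,
    ContDiffOn ℝ (⊤ : ℕ∞) (fun t => (γ t : Op N)) (Set.Ici 0) ∧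
    γ 0 = 1 ∧ (∀ t : ℝ, 0 ≤ t → γ t ∈ S) ∧
    HasDerivWithinAt (fun t => (γ t : Op N)) g (Set.Ici 0) 0}

/-- The elements `exp g`, `g ∈ w`, of `GL(her(N))`. -/
def expSet {N : ℕ} (w : Set (Op N)) : Set (GLHer N) :=
  {T | ∃ g ∈ w, (T : Op N) = NormedSpace.exp g}

/-- The closure in `GL(her(N))` of the semigroup `{e^{g₁} ⋯ e^{gₙ} | gᵢ ∈ w}` generated by
`exp w`. -/
def closedSemigroupExp {N : ℕ} (w : Set (Op N)) : Set (GLHer N) :=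
  closure (Submonoid.closure (expSet w) : Set (GLHer N))

/-- A wedge: a closed convex cone (containing `0`). -/
structure IsWedge {N : ℕ} (w : Set (Op N)) : Prop where
  isClosed : IsClosed w
  zero_mem : (0 : Op N) ∈ w
  add_mem : ∀ g ∈ w, ∀ h ∈ w, g + h ∈ w
  smul_mem : ∀ c : ℝ, 0 ≤ c → ∀ g ∈ w, c • g ∈ w

/-- A Lie wedge: a wedge `w` with `e^g w e^{-g} = w` for every `g` in its edge `w ∩ -w`. -/
structure IsLieWedge {N : ℕ} (w : Set (Op N)) : Prop extends IsWedge w where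
  conj_edge : ∀ g : Op N, g ∈ w → -g ∈ w →
    (fun h : Op N => NormedSpace.exp g * h * NormedSpace.exp (-g)) '' w = w

/-- A Lie subsemigroup: a closed subsemigroup `S` (with unity) of `GL(her(N))` that is the closure
of the semigroup generated by `exp L(S)`. -/
structure IsLieSubsemigroup {N : ℕ} (S : Set (GLHer N)) : Prop where
  one_mem : (1 : GLHer N) ∈ S
  mul_mem : ∀ A ∈ S, ∀ B ∈ S, A * B ∈ S
  isClosed : IsClosed S
  generated : S = closedSemigroupExp (tangentCone S)

/-! ### Invertible quantum channels -/

open scoped ComplexOrder in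
/-- Density matrices: positive semidefinite (in particular Hermitian) matrices of trace one. -/
def densityMatrices (ι : Type) [Fintype ι] : Set (Matrix ι ι ℂ) :=
  {ρ | ρ.PosSemidef ∧ ρ.trace = 1}

/-- The complex linear extension of an operator on `her(N)` to all complex matrices:
`A + i B ↦ T A + i T B` for Hermitian `A`, `B`. -/
def complexify {N : ℕ} (T : Op N) (M : Matrix (Fin N) (Fin N) ℂ) : Matrix (Fin N) (Fin N) ℂ :=
  (T ⟨(realPart M : Matrix (Fin N) (Fin N) ℂ), (realPart M).2⟩ : Matrix (Fin N) (Fin N) ℂ) +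
    Complex.I •
      (T ⟨(imaginaryPart M : Matrix (Fin N) (Fin N) ℂ), (imaginaryPart M).2⟩ :
        Matrix (Fin N) (Fin N) ℂ)

/-- The operator `T ⊗ 1_m` on complex matrices of size `N · m`: `T` acts on each of the `m × m`
blocks `(M_{(i,a),(j,b)})_{i,j}`. -/
def ampliate {N : ℕ} (T : Op N) (m : ℕ) (M : Matrix (Fin N × Fin m) (Fin N × Fin m) ℂ) :
    Matrix (Fin N × Fin m) (Fin N × Fin m) ℂ :=
  Matrix.of fun p q => complexify T (Matrix.of fun i j => M (i, p.2) (j, q.2)) p.1 q.1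

/-- `P`: the invertible operators on `her(N)` that map density matrices to density matrices
(positive and trace preserving). -/
def positiveTP (N : ℕ) : Set (GLHer N) :=
  {T | ∀ ρ : Her N, (ρ : Matrix (Fin N) (Fin N) ℂ) ∈ densityMatrices (Fin N) →
    ((T : Op N) ρ : Matrix (Fin N) (Fin N) ℂ) ∈ densityMatrices (Fin N)}

/-- Complete positivity, for trace preserving operators: each `T ⊗ 1_m` maps density matrices to
density matrices. -/
def IsCompletelyPositiveTP {N : ℕ} (T : Op N) : Prop :=
  ∀ m : ℕ, ∀ M ∈ densityMatrices (Fin N × Fin m),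
    ampliate T m M ∈ densityMatrices (Fin N × Fin m)

/-- `P^cp`: the semigroup of all invertible quantum channels on `her(N)`. -/
def invertibleChannels (N : ℕ) : Set (GLHer N) :=
  {T ∈ positiveTP N | IsCompletelyPositiveTP (T : Op N)}

/-- `P₀^cp`: the connected component of the identity in `P^cp`. -/
def invertibleChannels₀ (N : ℕ) : Set (GLHer N) :=
  connectedComponentIn (invertibleChannels N) 1

/-- `T`: the closure in `GL(her(N))` of the semigroup generated by `exp L(P₀^cp)`. -/
def lieSemigroupT (N : ℕ) : Set (GLHer N) :=
  closedSemigroupExp (tangentCone (invertibleChannels₀ N))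

/-! ### Kossakowski–Lindblad generators and Markovian channels -/

/-- The Liouvillian in Kossakowski–Lindblad form with Hamiltonian `H` and noise operators `V k`:
`𝓛 ρ = i [H, ρ] + ½ ∑ₖ (Vₖ† Vₖ ρ + ρ Vₖ† Vₖ - 2 Vₖ ρ Vₖ†)`. -/
def liouvillian {N r : ℕ} (H : Her N) (V : Fin r → Matrix (Fin N) (Fin N) ℂ)
    (ρ : Matrix (Fin N) (Fin N) ℂ) : Matrix (Fin N) (Fin N) ℂ :=
  Complex.I • ((H : Matrix (Fin N) (Fin N) ℂ) * ρ - ρ * (H : Matrix (Fin N) (Fin N) ℂ)) +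
    (1 / 2 : ℂ) • ∑ k, ((V k)ᴴ * V k * ρ + ρ * ((V k)ᴴ * V k) - (2 : ℂ) • (V k * ρ * (V k)ᴴ))

/-- The set of all Kossakowski–Lindblad generators: the operators `-𝓛` on `her(N)` with `𝓛` in
Kossakowski–Lindblad form. -/
def klGenerators (N : ℕ) : Set (Op N) :=
  {A | ∃ (H : Her N) (r : ℕ) (V : Fin r → Matrix (Fin N) (Fin N) ℂ),
    ∀ ρ : Her N, (A ρ : Matrix (Fin N) (Fin N) ℂ) = -liouvillian H V (ρ : Matrix (Fin N) (Fin N) ℂ)}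

/-- The time dependent Markovian channels: the values `X τ`, `τ ≥ 0`, of solutions on `[0, τ]` of
the master equation `X' = -L(t) X`, `X(0) = 1`, where every `-L(t)` is a Kossakowski–Lindblad
generator. Here `L` is an integrable function of time, and a solution is a continuous function that
satisfies the integrated equation (a Carathéodory solution). Solutions are automatically
invertible. -/
def markovianChannels (N : ℕ) : Set (GLHer N) :=
  {T | ∃ (τ : ℝ) (L X : ℝ → Op N), 0 ≤ τ ∧
    IntervalIntegrable L MeasureTheory.volume 0 τ ∧
    (∀ t ∈ Set.Icc 0 τ, -L t ∈ klGenerators N) ∧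
    ContinuousOn X (Set.Icc 0 τ) ∧
    (∀ t ∈ Set.Icc 0 τ, X t = 1 + ∫ s in (0 : ℝ)..t, -(L s * X s)) ∧
    X τ = (T : Op N)}

/-- The time dependent Markovian channels with a continuous Liouvillian: as before, but `L` is
continuous and the master equation holds in the classical sense at every time. -/
def continuousMarkovianChannels (N : ℕ) : Set (GLHer N) :=
  {T | ∃ (τ : ℝ) (L X : ℝ → Op N), 0 ≤ τ ∧
    ContinuousOn L (Set.Icc 0 τ) ∧
    (∀ t ∈ Set.Icc 0 τ, -L t ∈ klGenerators N) ∧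
    X 0 = 1 ∧
    (∀ t ∈ Set.Icc 0 τ, HasDerivWithinAt X (-(L t * X t)) (Set.Icc 0 τ) t) ∧
    X τ = (T : Op N)}

end MarkovLie

end

/-! The proof rests on a linear description of the Kossakowski–Lindblad generators: `A` is one iff
it annihilates the trace and its Choi matrix is nonnegative on the orthogonal complement of the
vectorised identity (`mem_klGenerators_iff`). These are closed homogeneous inequalities, so the
generators form a closed convex cone.

This cone is the tangent cone of any set of channels that contains its exponentials. A channel has a
positive semidefinite Choi matrix, and that of the identity vanishes on the complement in question.
Hence `T - 1` is a generator for every channel `T`, and velocities of curves of channels, being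
limits of difference quotients, are generators. Conversely, a generator is tangent at the identity
to a curve of completely positive maps and to a curve of trace preserving ones. Powers of short-time
values of such a curve converge to the exponential (`exp_mem_of_hasDerivWithinAt`), so the
exponential is a channel. The Lie wedge property follows by conjugating curves of channels.

For Markovian channels, a discrete Grönwall estimate (`exists_mem_norm_sub_le`) approximates a
solution by products of exponentials of the integrals of `-L` over short intervals; these integrals
stay in the cone (`mem_closure_of_evolution`). In the other direction, a product of exponentials is
itself the endpoint of a continuous evolution that switches its factors on and off in turn
(`exists_evolution_of_mem_closure`). -/

noncomputable section

namespace MarkovLie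

open Matrix
open scoped ComplexOrder Topology

variable {N : ℕ}

/-! ### The complexification of a superoperator -/

/-- The complexification of an operator on `her(N)` as a complex linear map. -/
def complexifyₗ (T : Op N) : Matrix (Fin N) (Fin N) ℂ →ₗ[ℂ] Matrix (Fin N) (Fin N) ℂ where
  toFun := complexify T
  map_add' A B := by
    have h (x y : Matrix (Fin N) (Fin N) ℂ) (hx hy hxy) :
        T ⟨x + y, hxy⟩ = T ⟨x, hx⟩ + T ⟨y, hy⟩ := by rw [← map_add]; rfl
    simp only [complexify, map_add, AddSubgroup.coe_add]
    rw [h _ _ (realPart A).2 (realPart B).2, h _ _ (imaginaryPart A).2 (imaginaryPart B).2]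
    simp only [Submodule.coe_add, smul_add]
    abel
  map_smul' z A := by
    have h (r s : ℝ) (x y : Matrix (Fin N) (Fin N) ℂ) (hx hy hxy) :
        T ⟨r • x + s • y, hxy⟩ = r • T ⟨x, hx⟩ + s • T ⟨y, hy⟩ := by
      rw [← map_smul, ← map_smul, ← map_add]; rfl
    have h1 : (realPart (z • A) : Matrix (Fin N) (Fin N) ℂ) =
        z.re • (realPart A : Matrix (Fin N) (Fin N) ℂ) +
          (-z.im) • (imaginaryPart A : Matrix (Fin N) (Fin N) ℂ) := by
      rw [realPart_smul, neg_smul, ← sub_eq_add_neg]; rfl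
    have h2 : (imaginaryPart (z • A) : Matrix (Fin N) (Fin N) ℂ) =
        z.re • (imaginaryPart A : Matrix (Fin N) (Fin N) ℂ) +
          z.im • (realPart A : Matrix (Fin N) (Fin N) ℂ) := by
      rw [imaginaryPart_smul]; rfl
    simp only [complexify, h1, h2]
    rw [h _ _ _ _ (realPart A).2 (imaginaryPart A).2, h _ _ _ _ (imaginaryPart A).2 (realPart A).2]
    simp only [Submodule.coe_add, Submodule.coe_smul, RingHom.id_apply]
    ext i j
    simp only [Matrix.add_apply, Matrix.smul_apply, Complex.real_smul, smul_eq_mul]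
    apply Complex.ext <;> simp <;> ring

theorem complexifyₗ_apply (T : Op N) (M : Matrix (Fin N) (Fin N) ℂ) :
    complexifyₗ T M = complexify T M := rfl

theorem complexify_coe (T : Op N) (ρ : Her N) :
    complexify T (ρ : Matrix (Fin N) (Fin N) ℂ) = (T ρ : Matrix (Fin N) (Fin N) ℂ) := by
  have h1 : (realPart (ρ : Matrix (Fin N) (Fin N) ℂ) : Matrix (Fin N) (Fin N) ℂ) = ρ :=
    IsSelfAdjoint.coe_realPart ρ.2
  have h2 : (imaginaryPart (ρ : Matrix (Fin N) (Fin N) ℂ) : Matrix (Fin N) (Fin N) ℂ) = 0 := by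
    rw [IsSelfAdjoint.imaginaryPart ρ.2]; rfl
  simp only [complexify, h1, h2]
  have : T ⟨0, by simp⟩ = 0 := map_zero T
  rw [this]
  simp

/-- A complex linear map that agrees with `T` on `her(N)` is the complexification of `T`. -/
theorem complexify_eq_of_forall_her (T : Op N)
    (F : Matrix (Fin N) (Fin N) ℂ →ₗ[ℂ] Matrix (Fin N) (Fin N) ℂ)
    (h : ∀ ρ : Her N, (T ρ : Matrix (Fin N) (Fin N) ℂ) = F ρ) (M : Matrix (Fin N) (Fin N) ℂ) :
    complexify T M = F M := by
  conv_rhs => rw [← realPart_add_I_smul_imaginaryPart M]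
  rw [map_add, map_smul, complexify, h, h]

theorem complexify_mul (S T : Op N) (M : Matrix (Fin N) (Fin N) ℂ) :
    complexify (S * T) M = complexify S (complexify T M) :=
  complexify_eq_of_forall_her (S * T) (complexifyₗ S ∘ₗ complexifyₗ T) (fun ρ => by
    simp only [LinearMap.comp_apply, complexifyₗ_apply, complexify_coe]; rfl) M

theorem complexify_one (M : Matrix (Fin N) (Fin N) ℂ) : complexify (1 : Op N) M = M :=
  complexify_eq_of_forall_her 1 LinearMap.id (fun _ => rfl) M

theorem complexify_add (S T : Op N) (M : Matrix (Fin N) (Fin N) ℂ) :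
    complexify (S + T) M = complexify S M + complexify T M :=
  complexify_eq_of_forall_her (S + T) (complexifyₗ S + complexifyₗ T) (fun ρ => by
    simp only [LinearMap.add_apply, complexifyₗ_apply, complexify_coe]; rfl) M

theorem complexify_smul (c : ℝ) (T : Op N) (M : Matrix (Fin N) (Fin N) ℂ) :
    complexify (c • T) M = (c : ℂ) • complexify T M :=
  complexify_eq_of_forall_her (c • T) ((c : ℂ) • complexifyₗ T) (fun ρ => by
    simp only [LinearMap.smul_apply, complexifyₗ_apply, complexify_coe]; rfl) M

theorem complexify_conjTranspose (T : Op N) (M : Matrix (Fin N) (Fin N) ℂ) :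
    complexify T Mᴴ = (complexify T M)ᴴ := by
  have hs (x : Her N) : (x : Matrix (Fin N) (Fin N) ℂ)ᴴ = x := x.2
  have h : Mᴴ = (realPart M : Matrix (Fin N) (Fin N) ℂ) -
      Complex.I • (imaginaryPart M : Matrix (Fin N) (Fin N) ℂ) := by
    conv_lhs => rw [← realPart_add_I_smul_imaginaryPart M]
    rw [conjTranspose_add, conjTranspose_smul]
    rw [show (realPart M : Matrix (Fin N) (Fin N) ℂ)ᴴ = _ from (realPart M).2,
      show (imaginaryPart M : Matrix (Fin N) (Fin N) ℂ)ᴴ = _ from (imaginaryPart M).2]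
    simp [sub_eq_add_neg]
  rw [h, ← complexifyₗ_apply, map_sub, map_smul, complexifyₗ_apply, complexifyₗ_apply]
  have e1 := complexify_coe T ⟨_, (realPart M).2⟩
  have e2 := complexify_coe T ⟨_, (imaginaryPart M).2⟩
  simp only at e1 e2
  rw [e1, e2, complexify, conjTranspose_add, conjTranspose_smul, hs, hs]
  simp [sub_eq_add_neg]

theorem continuous_complexify (M : Matrix (Fin N) (Fin N) ℂ) :
    Continuous fun T : Op N => complexify T M := by
  unfold complexify
  fun_prop

/-! ### The Choi matrix -/

/-- The Choi matrix of an operator on `her(N)`: its `(i,a),(j,b)` entry is `T(E_{ab})_{ij}`. -/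
def choi (T : Op N) : Matrix (Fin N × Fin N) (Fin N × Fin N) ℂ :=
  Matrix.of fun p q => complexify T (Matrix.single p.2 q.2 1) p.1 q.1

theorem choi_isHermitian (T : Op N) : (choi T).IsHermitian := by
  ext ⟨i, a⟩ ⟨j, b⟩
  simp only [conjTranspose_apply, choi, of_apply]
  rw [← conjTranspose_apply, ← complexify_conjTranspose]
  simp

theorem continuous_choi : Continuous (choi : Op N → _) := by
  refine continuous_matrix fun p q => ?_
  exact (continuous_complexify _).matrix_elem _ _
/-! ### Kossakowski–Lindblad generators are the conditionally completely positive operators -/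

/-- A Hermitian form that is nonnegative on the orthogonal complement of `ω` is a sum of a positive
semidefinite form and a form `|g⟩⟨ω| + |ω⟩⟨g|`. -/
theorem exists_eq_sum_vecMulVec_add {ι : Type*} [Fintype ι] [DecidableEq ι] {C : Matrix ι ι ℂ}
    (hC : C.IsHermitian) (ω : ι → ℂ)
    (h : ∀ x : ι → ℂ, star ω ⬝ᵥ x = 0 → 0 ≤ star x ⬝ᵥ (C *ᵥ x)) :
    ∃ (r : ℕ) (v : Fin r → ι → ℂ) (g : ι → ℂ),
      C = ∑ k, vecMulVec (v k) (star (v k)) + vecMulVec g (star ω) + vecMulVec ω (star g) := by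
  set n : ℂ := star ω ⬝ᵥ ω with hn
  have hnstar : star n = n := by rw [hn, ← star_dotProduct]
  set W : Matrix ι ι ℂ := vecMulVec ω (star ω) with hW
  -- The orthogonal projection onto the complement of `ω`. For `ω = 0` the convention `0⁻¹ = 0`
  -- gives `P = 1`, as it should.
  set P : Matrix ι ι ℂ := 1 - n⁻¹ • W with hP
  have hWH : Wᴴ = W := by rw [hW, conjTranspose_vecMulVec, star_star]
  have hPH : Pᴴ = P := by
    rw [hP, conjTranspose_sub, conjTranspose_smul, hWH, conjTranspose_one, star_inv₀, hnstar]
  have hPω (x : ι → ℂ) : star ω ⬝ᵥ (P *ᵥ x) = 0 := by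
    rw [hP, sub_mulVec, smul_mulVec, one_mulVec, hW, vecMulVec_mulVec, dotProduct_sub,
      dotProduct_smul]
    simp only [op_smul_eq_smul, dotProduct_smul, ← hn, smul_eq_mul]
    by_cases h0 : n = 0
    · have : ω = 0 := dotProduct_star_self_eq_zero.mp (by rw [← h0, hn, dotProduct_comm])
      simp [this]
    · field_simp
      ring
  have hD : (P * C * P).PosSemidef := by
    have hs (x : ι → ℂ) : star x ⬝ᵥ ((P * C * P) *ᵥ x) = star (P *ᵥ x) ⬝ᵥ (C *ᵥ (P *ᵥ x)) := by
      rw [star_mulVec, hPH, ← mulVec_mulVec, ← mulVec_mulVec, dotProduct_mulVec _ P]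
    refine .of_dotProduct_mulVec_nonneg ?_ fun x => ?_
    · rw [IsHermitian, conjTranspose_mul, conjTranspose_mul, hPH, hC.eq, mul_assoc]
    · rw [hs]
      exact h _ (hPω x)
  obtain ⟨r, v, hv⟩ := posSemidef_iff_eq_sum_vecMulVec.mp hD
  set u : ι → ℂ := C *ᵥ ω with hu
  set s : ℂ := star ω ⬝ᵥ u with hs
  have hωC : star ω ᵥ* C = star u := by rw [hu, star_mulVec, hC.eq]
  have hsstar : star s = s := by
    rw [hs, ← star_dotProduct, hu, ← hωC, ← dotProduct_mulVec]
  have hWC : W * C = vecMulVec ω (star u) := by rw [hW, vecMulVec_mul, hωC]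
  have hCW : C * W = vecMulVec u (star ω) := by rw [hW, mul_vecMulVec]
  have hWCW : W * C * W = s • W := by
    rw [mul_assoc, hCW, hW, vecMulVec_mul_vecMulVec, ← hs]
    simp [vecMulVec_smul]
  -- Expanding `P C P` leaves the terms `(W C + C W)/n - s W/n²` to be accounted for. The last is
  -- split evenly between the two conjugate rank-one terms, whence the factor `1/2`.
  refine ⟨r, v, n⁻¹ • u - (n⁻¹ * n⁻¹ * s / 2) • ω, ?_⟩
  have hstar : star (n⁻¹ • u - (n⁻¹ * n⁻¹ * s / 2) • ω) =
      n⁻¹ • star u - (n⁻¹ * n⁻¹ * s / 2) • star ω := by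
    rw [star_sub, star_smul, star_smul, star_inv₀, hnstar]
    simp only [star_div₀, star_mul', hsstar, star_inv₀, hnstar]
    norm_num
  have hPCP : P * C * P =
      C - n⁻¹ • (W * C) - n⁻¹ • (C * W) + (n⁻¹ * n⁻¹) • (W * C * W) := by
    rw [hP]
    simp only [sub_mul, mul_sub, one_mul, mul_one, smul_mul_assoc, mul_smul_comm, smul_sub,
      smul_smul]
    abel
  rw [← hv, hstar, hPCP, hWCW, hWC, hCW, hW]
  ext i j
  simp only [Matrix.add_apply, Matrix.sub_apply, Matrix.smul_apply,
    vecMulVec_apply, Pi.sub_apply, Pi.smul_apply, smul_eq_mul]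
  ring

/-- The vectorised identity matrix. -/
def vecOne (N : ℕ) : Fin N × Fin N → ℂ := fun p => if p.1 = p.2 then 1 else 0

theorem star_vecOne : star (vecOne N) = vecOne N := by
  ext p
  simp only [vecOne, Pi.star_apply]
  split_ifs <;> simp

/-- The linear map `ρ ↦ ∑ₖ Vₖ ρ Vₖ† + G ρ + ρ G†`. -/
def krausAdd {r : ℕ} (V : Fin r → Matrix (Fin N) (Fin N) ℂ) (G : Matrix (Fin N) (Fin N) ℂ) :
    Matrix (Fin N) (Fin N) ℂ →ₗ[ℂ] Matrix (Fin N) (Fin N) ℂ where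
  toFun M := ∑ k, V k * M * (V k)ᴴ + G * M + M * Gᴴ
  map_add' A B := by
    simp only [mul_add, add_mul, Finset.sum_add_distrib]
    abel
  map_smul' c A := by
    simp only [mul_smul_comm, smul_mul_assoc, ← Finset.smul_sum, smul_add, RingHom.id_apply]

theorem krausAdd_apply {r : ℕ} (V : Fin r → Matrix (Fin N) (Fin N) ℂ)
    (G M : Matrix (Fin N) (Fin N) ℂ) :
    krausAdd V G M = ∑ k, V k * M * (V k)ᴴ + G * M + M * Gᴴ := rfl

/-- Since `(A E_{ab} B)_{ij} = A_{ia} B_{bj}`, conjugation by `V` has a rank-one Choi matrix built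
from the vectorised `V`. One-sided multiplication is the case in which one factor is the identity.
-/
theorem krausAdd_single {r : ℕ} (V : Fin r → Matrix (Fin N) (Fin N) ℂ)
    (G : Matrix (Fin N) (Fin N) ℂ) (p q : Fin N × Fin N) :
    krausAdd V G (single p.2 q.2 1) p.1 q.1 =
      (∑ k, vecMulVec (fun p : Fin N × Fin N => V k p.1 p.2)
          (star fun p : Fin N × Fin N => V k p.1 p.2) +
        vecMulVec (fun p : Fin N × Fin N => G p.1 p.2) (star (vecOne N)) +
        vecMulVec (vecOne N) (star fun p : Fin N × Fin N => G p.1 p.2)) p q := by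
  have h1 (A B : Matrix (Fin N) (Fin N) ℂ) :
      (A * (single p.2 q.2 1 : Matrix (Fin N) (Fin N) ℂ) * B : Matrix (Fin N) (Fin N) ℂ) p.1 q.1 =
        A p.1 p.2 * B q.2 q.1 := by
    rw [mul_assoc, mul_apply, Finset.sum_eq_single p.2]
    · simp
    · intro b _ hb
      simp [hb]
    · simp
  have h2 := h1 G 1
  have h3 := h1 1 Gᴴ
  rw [mul_one] at h2
  rw [one_mul] at h3
  rw [krausAdd_apply, Matrix.add_apply, Matrix.add_apply, h2, h3, star_vecOne]
  simp only [Matrix.sum_apply, h1, Matrix.add_apply, vecMulVec_apply, vecOne, one_apply,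
    Pi.star_apply, conjTranspose_apply]
  simp only [eq_comm]

/-- The Choi matrix lists the values on matrix units, so it determines the operator. This dictionary
turns the structure of generators into a question about Hermitian forms. -/
theorem complexify_eq_krausAdd_iff {r : ℕ} (A : Op N) (V : Fin r → Matrix (Fin N) (Fin N) ℂ)
    (G : Matrix (Fin N) (Fin N) ℂ) :
    (∀ M, complexify A M = krausAdd V G M) ↔
      choi A = ∑ k, vecMulVec (fun p : Fin N × Fin N => V k p.1 p.2)
          (star fun p : Fin N × Fin N => V k p.1 p.2) +
        vecMulVec (fun p : Fin N × Fin N => G p.1 p.2) (star (vecOne N)) +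
        vecMulVec (vecOne N) (star fun p : Fin N × Fin N => G p.1 p.2) := by
  constructor
  · intro h
    ext p q
    rw [← krausAdd_single, ← h]
    rfl
  · intro h M
    have key : complexifyₗ A = krausAdd V G := by
      refine Matrix.ext_linearMap ℂ fun a b => LinearMap.ext_ring ?_
      ext i j
      have h1 := krausAdd_single V G (i, a) (j, b)
      rw [← h] at h1
      exact h1.symm
    rw [← key]
    rfl

theorem trace_krausAdd {r : ℕ} (V : Fin r → Matrix (Fin N) (Fin N) ℂ)
    (G M : Matrix (Fin N) (Fin N) ℂ) :
    (krausAdd V G M).trace = ((∑ k, (V k)ᴴ * V k + G + Gᴴ) * M).trace := by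
  rw [krausAdd_apply, trace_add, trace_add, trace_sum, add_mul, add_mul, trace_add, trace_add,
    Finset.sum_mul, trace_sum, trace_mul_comm M]
  congr 2
  exact Finset.sum_congr rfl fun k _ => by rw [trace_mul_comm, mul_assoc]

/-- The non-Hermitian effective Hamiltonian: `-𝓛 ρ = ∑ₖ Vₖ ρ Vₖ† + G ρ + ρ G†`. -/
theorem neg_liouvillian_eq_krausAdd {r : ℕ} (H : Her N) (V : Fin r → Matrix (Fin N) (Fin N) ℂ)
    (M : Matrix (Fin N) (Fin N) ℂ) :
    -liouvillian H V M = krausAdd V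
      (-(Complex.I • (H : Matrix (Fin N) (Fin N) ℂ) + (1 / 2 : ℂ) • ∑ k, (V k)ᴴ * V k)) M := by
  have hH : (H : Matrix (Fin N) (Fin N) ℂ)ᴴ = H := H.2
  have hW : (∑ k, (V k)ᴴ * V k)ᴴ = ∑ k, (V k)ᴴ * V k := by
    simp [conjTranspose_sum]
  have hs : ∑ k, ((V k)ᴴ * V k * M + M * ((V k)ᴴ * V k) - (2 : ℂ) • (V k * M * (V k)ᴴ)) =
      (∑ k, (V k)ᴴ * V k) * M + M * (∑ k, (V k)ᴴ * V k) - (2 : ℂ) • ∑ k, V k * M * (V k)ᴴ := by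
    rw [Finset.sum_sub_distrib, Finset.sum_add_distrib, Finset.sum_mul, Finset.mul_sum,
      Finset.smul_sum]
  rw [liouvillian, krausAdd_apply, hs, conjTranspose_neg, conjTranspose_add, conjTranspose_smul,
    conjTranspose_smul, hH, hW]
  simp only [neg_mul, mul_neg, add_mul, mul_add, smul_mul_assoc, mul_smul_comm]
  ext i j
  simp only [Matrix.neg_apply, Matrix.add_apply, Matrix.sub_apply, Matrix.smul_apply,
    smul_eq_mul, RCLike.star_def, Complex.conj_I, map_div₀, map_one, map_ofNat]
  ring

theorem complexify_eq_krausAdd_of_mem {A : Op N} (hA : A ∈ klGenerators N) :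
    ∃ (r : ℕ) (V : Fin r → Matrix (Fin N) (Fin N) ℂ) (G : Matrix (Fin N) (Fin N) ℂ),
      (∑ k, (V k)ᴴ * V k + G + Gᴴ = 0) ∧ ∀ M, complexify A M = krausAdd V G M := by
  obtain ⟨H, r, V, h⟩ := hA
  refine ⟨r, V, _, ?_, complexify_eq_of_forall_her A _ fun ρ => by
    rw [h, neg_liouvillian_eq_krausAdd]⟩
  have hH : (H : Matrix (Fin N) (Fin N) ℂ)ᴴ = H := H.2
  have hW : (∑ k, (V k)ᴴ * V k)ᴴ = ∑ k, (V k)ᴴ * V k := by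
    simp [conjTranspose_sum]
  rw [conjTranspose_neg, conjTranspose_add, conjTranspose_smul,
    conjTranspose_smul, hH, hW]
  ext i j
  simp only [Matrix.neg_apply, Matrix.add_apply, Matrix.smul_apply,
    smul_eq_mul, RCLike.star_def, Complex.conj_I, map_div₀, map_one, map_ofNat, Matrix.zero_apply]
  ring

/-- The trace condition fixes the Hermitian part of `G` to be `-½ ∑ Vₖ† Vₖ`. The anti-Hermitian part
is `-i H` with `H = (i/2)(G - G†)`. -/
theorem mem_klGenerators_of_complexify_eq {A : Op N} {r : ℕ}
    (V : Fin r → Matrix (Fin N) (Fin N) ℂ) (G : Matrix (Fin N) (Fin N) ℂ)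
    (hG : ∑ k, (V k)ᴴ * V k + G + Gᴴ = 0) (h : ∀ M, complexify A M = krausAdd V G M) :
    A ∈ klGenerators N := by
  have hH : ((Complex.I / 2) • (G - Gᴴ))ᴴ = (Complex.I / 2) • (G - Gᴴ) := by
    rw [conjTranspose_smul, conjTranspose_sub, conjTranspose_conjTranspose]
    ext i j
    simp only [Matrix.sub_apply, Matrix.smul_apply, smul_eq_mul, RCLike.star_def,
      Complex.conj_I, map_div₀, map_ofNat]
    ring
  refine ⟨⟨(Complex.I / 2) • (G - Gᴴ), hH⟩, r, V, fun ρ => ?_⟩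
  rw [← complexify_coe, h, neg_liouvillian_eq_krausAdd]
  congr 2
  have hW : ∑ k, (V k)ᴴ * V k = -(G + Gᴴ) := by
    rw [add_assoc] at hG
    exact eq_neg_of_add_eq_zero_left hG
  rw [hW]
  ext i j
  simp only [Matrix.sub_apply, Matrix.add_apply, Matrix.neg_apply, Matrix.smul_apply, smul_eq_mul]
  linear_combination ((G i j - Gᴴ i j) / 2) * Complex.I_mul_I

/-- Conditional complete positivity. On the complement of `vecOne N` the terms in `G` drop out and
only the positive Kraus part remains; the converse recovers `V` and `G` from
`exists_eq_sum_vecMulVec_add`. -/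
theorem mem_klGenerators_iff (A : Op N) :
    A ∈ klGenerators N ↔ (∀ M, (complexify A M).trace = 0) ∧
      ∀ x : Fin N × Fin N → ℂ, vecOne N ⬝ᵥ x = 0 → 0 ≤ star x ⬝ᵥ (choi A *ᵥ x) := by
  constructor
  · intro hA
    obtain ⟨r, V, G, hG, h⟩ := complexify_eq_krausAdd_of_mem hA
    refine ⟨fun M => by rw [h, trace_krausAdd, hG, zero_mul, trace_zero], fun x hx => ?_⟩
    have hx' : star x ⬝ᵥ vecOne N = 0 := by
      rw [star_dotProduct, star_vecOne, hx, star_zero]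
    rw [(complexify_eq_krausAdd_iff A V G).mp h, add_mulVec, add_mulVec, dotProduct_add,
      dotProduct_add, vecMulVec_mulVec, vecMulVec_mulVec, star_vecOne, hx]
    simp only [op_smul_eq_smul, zero_smul, dotProduct_zero, add_zero, dotProduct_smul,
      hx', smul_zero]
    exact (posSemidef_sum _ fun k _ => posSemidef_vecMulVec_self_star _).dotProduct_mulVec_nonneg x
  · rintro ⟨htr, hpos⟩
    obtain ⟨r, v, g, hC⟩ := exists_eq_sum_vecMulVec_add (choi_isHermitian A) (vecOne N)
      (by rw [star_vecOne]; exact hpos)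
    have h := (complexify_eq_krausAdd_iff A (fun k => Matrix.of fun i a => v k (i, a))
      (Matrix.of fun i a => g (i, a))).mpr (by simpa using hC)
    refine mem_klGenerators_of_complexify_eq _ _ ?_ h
    -- The trace pairing is nondegenerate, so annihilating every trace forces the matrix identity.
    rw [ext_iff_trace_mul_right]
    intro M
    rw [← trace_krausAdd, ← h, htr, zero_mul, trace_zero]

/-! ### The generators form a closed convex cone -/

theorem choi_add (A B : Op N) : choi (A + B) = choi A + choi B := by
  ext p q
  simp [choi, complexify_add]

theorem choi_smul (c : ℝ) (A : Op N) : choi (c • A) = (c : ℂ) • choi A := by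
  ext p q
  simp [choi, complexify_smul]

theorem isWedge_klGenerators : IsWedge (klGenerators N) where
  zero_mem := ⟨0, 0, Fin.elim0, fun ρ => by simp [liouvillian]⟩
  isClosed := by
    have : klGenerators N = (⋂ M, {A | (complexify A M).trace = 0}) ∩
        ⋂ x : {x : Fin N × Fin N → ℂ // vecOne N ⬝ᵥ x = 0},
          {A | 0 ≤ star x.1 ⬝ᵥ (choi A *ᵥ x.1)} := by
      ext A
      simp [mem_klGenerators_iff]
    rw [this]
    refine (isClosed_iInter fun M => ?_).inter (isClosed_iInter fun x => ?_)
    · exact isClosed_eq (continuous_complexify M).matrix_trace continuous_const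
    · exact isClosed_le continuous_const
        (continuous_const.dotProduct (continuous_choi.matrix_mulVec continuous_const))
  add_mem A hA B hB := by
    rw [mem_klGenerators_iff] at *
    refine ⟨fun M => by rw [complexify_add, trace_add, hA.1, hB.1, add_zero], fun x hx => ?_⟩
    rw [choi_add, add_mulVec, dotProduct_add]
    exact add_nonneg (hA.2 x hx) (hB.2 x hx)
  smul_mem c hc A hA := by
    rw [mem_klGenerators_iff] at *
    refine ⟨fun M => by rw [complexify_smul, trace_smul, hA.1, smul_zero], fun x hx => ?_⟩
    rw [choi_smul, smul_mulVec, dotProduct_smul]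
    exact mul_nonneg (by exact_mod_cast hc) (hA.2 x hx)

end MarkovLie

namespace MarkovLie

open Filter
open scoped Topology

/-! ### Approximation by products in a Banach algebra -/

section BanachAlgebra

variable {R : Type*} [NormedRing R]

/-- A discrete Grönwall estimate: a sequence that follows up to small errors the multiplication by
elements of a monoid stays close to the monoid. -/
theorem exists_mem_norm_sub_le (C : Submonoid R) (x P : ℕ → R) (l : ℕ → ℝ) (n : ℕ) {ε : ℝ}
    (hε : 0 ≤ ε) (hx0 : x 0 = 1) (hl : ∀ i < n, 0 ≤ l i) (hP : ∀ i < n, P i ∈ C)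
    (hPn : ∀ i < n, ∀ v, ‖P i * v‖ ≤ Real.exp (2 * l i) * ‖v‖)
    (hstep : ∀ i < n, ‖x (i + 1) - P i * x i‖ ≤ ε * l i) :
    ∃ Q ∈ C, ‖Q - x n‖ ≤
      ε * (∑ i ∈ Finset.range n, l i) * Real.exp (2 * ∑ i ∈ Finset.range n, l i) := by
  induction n with
  | zero => exact ⟨1, C.one_mem, by simp [hx0]⟩
  | succ n ih =>
    obtain ⟨Q, hQ, hn⟩ := ih (fun i hi => hl i (by omega)) (fun i hi => hP i (by omega))
      (fun i hi => hPn i (by omega)) (fun i hi => hstep i (by omega))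
    refine ⟨P n * Q, C.mul_mem (hP n (by omega)) hQ, ?_⟩
    have hln := hl n (by omega)
    have hs : 0 ≤ ∑ i ∈ Finset.range n, l i :=
      Finset.sum_nonneg fun i hi => hl i (by have := Finset.mem_range.mp hi; omega)
    rw [Finset.sum_range_succ]
    set s := ∑ i ∈ Finset.range n, l i
    have h1 : P n * Q - x (n + 1) = P n * (Q - x n) - (x (n + 1) - P n * x n) := by noncomm_ring
    have h2 : 1 ≤ Real.exp (2 * (s + l n)) := Real.one_le_exp (by linarith)
    calc ‖P n * Q - x (n + 1)‖
        ≤ ‖P n * (Q - x n)‖ + ‖x (n + 1) - P n * x n‖ := by rw [h1]; exact norm_sub_le _ _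
      _ ≤ Real.exp (2 * l n) * (ε * s * Real.exp (2 * s)) + ε * l n * 1 := by
          rw [mul_one]
          exact add_le_add ((hPn n (by omega) _).trans (by gcongr)) (hstep n (by omega))
      _ ≤ ε * s * Real.exp (2 * (s + l n)) + ε * l n * Real.exp (2 * (s + l n)) := by
          refine add_le_add (le_of_eq ?_) (by gcongr)
          rw [show 2 * (s + l n) = 2 * l n + 2 * s by ring, Real.exp_add]
          ring
      _ = _ := by ring

variable [NormedAlgebra ℝ R] [CompleteSpace R]

theorem hasDerivAt_exp_smul (A : R) (t : ℝ) :
    HasDerivAt (fun u : ℝ => NormedSpace.exp (u • A)) (A * NormedSpace.exp (t • A)) t :=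
  hasDerivAt_exp_smul_const' A t

theorem exp_add_smul (A : R) (s t : ℝ) :
    NormedSpace.exp ((s + t) • A) = NormedSpace.exp (s • A) * NormedSpace.exp (t • A) := by
  let _ := NormedAlgebra.restrictScalars ℚ ℝ R
  rw [add_smul]
  exact NormedSpace.exp_add_of_commute (((Commute.refl A).smul_left s).smul_right t)

theorem exp_mul_exp_neg (A : R) : NormedSpace.exp A * NormedSpace.exp (-A) = 1 := by
  have h := exp_add_smul A 1 (-1)
  simpa using h.symm

theorem exp_neg_mul_exp (A : R) : NormedSpace.exp (-A) * NormedSpace.exp A = 1 := by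
  simpa using exp_mul_exp_neg (-A)

/-- A closed submonoid that contains a curve tangent to `A` at the identity contains `exp A`. -/
theorem exp_mem_of_hasDerivWithinAt (C : Submonoid R) (hC : IsClosed (C : Set R)) (F : ℝ → R)
    (A : R) (hF : ∀ h, 0 < h → F h ∈ C) (hF0 : F 0 = 1)
    (hd : HasDerivWithinAt F A (Set.Ici 0) 0) : NormedSpace.exp A ∈ C := by
  have hcont : Continuous fun u : ℝ => NormedSpace.exp (u • A) :=
    continuous_iff_continuousAt.mpr fun t => (hasDerivAt_exp_smul A t).continuousAt
  obtain ⟨M, hM⟩ := (isCompact_Icc (a := (0 : ℝ)) (b := 1)).exists_bound_of_continuousOn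
    hcont.continuousOn
  have hM0 : 0 ≤ M := (norm_nonneg _).trans (hM 0 (by simp))
  -- The summand `1` absorbs the error in `‖F h - 1‖ ≤ (‖A‖ + ε) h` and also makes `a ≥ 1`, so that
  -- a step error `ε M h` is at most `ε M (a h)`.
  set a : ℝ := ‖A‖ + 1 with ha
  have ha0 : 0 < a := by positivity
  refine hC.closure_subset (Metric.mem_closure_iff.mpr fun δ hδ => ?_)
  set K : ℝ := M * a * Real.exp (2 * a) with hK
  have hK0 : 0 ≤ K := by positivity
  obtain ⟨ε, hε, hε1, hεK⟩ : ∃ ε : ℝ, 0 < ε ∧ ε ≤ 1 ∧ ε * K < δ := by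
    refine ⟨min 1 (δ / (K + 1)), by positivity, min_le_left _ _, ?_⟩
    calc min 1 (δ / (K + 1)) * K ≤ δ / (K + 1) * K := by gcongr; exact min_le_right _ _
      _ < δ := by rw [div_mul_eq_mul_div, div_lt_iff₀ (by positivity)]; nlinarith
  have h1 := hasDerivWithinAt_iff_isLittleO.mp hd
  have h2 := hasDerivWithinAt_iff_isLittleO.mp
    ((hasDerivAt_exp_smul A 0).hasDerivWithinAt (s := Set.Ici (0 : ℝ)))
  have hb := (h1.def hε).and ((h2.sub h1).def hε)
  have hlim : Tendsto (fun n : ℕ => 1 / ((n : ℝ) + 1)) atTop (𝓝[Set.Ici 0] 0) :=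
    tendsto_nhdsWithin_iff.mpr ⟨tendsto_one_div_add_atTop_nhds_zero_nat,
      Eventually.of_forall fun n => by simp only [Set.mem_Ici]; positivity⟩
  obtain ⟨n, hn1, hn2⟩ := (hlim.eventually hb).exists
  set h : ℝ := 1 / ((n : ℝ) + 1) with hh
  have hpos : 0 < h := by positivity
  simp only [hF0, sub_zero, zero_smul, NormedSpace.exp_zero, mul_one, Real.norm_eq_abs,
    abs_of_pos hpos] at hn1 hn2
  have hn3 : ‖NormedSpace.exp (h • A) - F h‖ ≤ ε * h := by
    refine le_of_eq_of_le ?_ hn2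
    congr 1
    abel
  have hFA : ‖F h - 1‖ ≤ a * h := by
    have e : F h - 1 = (F h - 1 - h • A) + h • A := by abel
    rw [e]
    refine (norm_add_le _ _).trans ?_
    rw [norm_smul, Real.norm_eq_abs, abs_of_pos hpos]
    nlinarith
  have hnh : ((n : ℝ) + 1) * h = 1 := by rw [hh]; field_simp
  -- The points `exp (i h A)` are compared with the powers of `F h`, where `(n + 1) h = 1`. Both `F
  -- h` and `exp (h A)` equal `1 + h A` up to `o(h)`.
  obtain ⟨Q, hQ, hQn⟩ := exists_mem_norm_sub_le C (fun i => NormedSpace.exp (((i : ℝ) * h) • A))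
    (fun _ => F h) (fun _ => a * h) (n + 1) (ε := ε * M) (by positivity) (by simp)
    (fun _ _ => by positivity) (fun _ _ => hF h hpos)
    -- The growth bound concerns `v ↦ F h * v` and not `‖F h‖`, because a normed ring need not
    -- satisfy `‖1‖ = 1`.
    (fun _ _ v => by
      have e : F h * v = v + (F h - 1) * v := by noncomm_ring
      rw [e]
      refine (norm_add_le _ _).trans ?_
      have e1 := norm_mul_le_of_le hFA (le_refl ‖v‖)
      have e2 := Real.add_one_le_exp (2 * (a * h))
      have e3 : 0 < a * h := by positivity
      nlinarith [norm_nonneg v])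
    (fun i hi => by
      have e : ((i + 1 : ℕ) : ℝ) * h = h + i * h := by push_cast; ring
      rw [e, exp_add_smul, ← sub_mul]
      have hi' : (i : ℝ) * h ∈ Set.Icc (0 : ℝ) 1 := by
        refine ⟨by positivity, ?_⟩
        have : (i : ℝ) ≤ n + 1 := by exact_mod_cast hi.le
        rw [← hnh]
        gcongr
      refine (norm_mul_le_of_le hn3 (hM _ hi')).trans ?_
      have : 1 ≤ a := by rw [ha]; linarith [norm_nonneg A]
      have h0 : 0 ≤ ε * M * h := by positivity
      nlinarith)
  refine ⟨Q, hQ, ?_⟩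
  rw [dist_comm, dist_eq_norm]
  have hsum : ∑ _i ∈ Finset.range (n + 1), a * h = a := by
    rw [Finset.sum_const, Finset.card_range, nsmul_eq_mul]
    push_cast
    rw [mul_left_comm, hnh, mul_one]
  rw [hsum] at hQn
  have e : (((n + 1 : ℕ) : ℝ) * h) • A = A := by push_cast; rw [hnh, one_smul]
  simp only [e] at hQn
  calc ‖Q - NormedSpace.exp A‖ ≤ ε * M * a * Real.exp (2 * a) := hQn
    _ = ε * K := by rw [hK]; ring
    _ < δ := hεK

end BanachAlgebra
end MarkovLie

namespace MarkovLie

open Matrix Filter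
open scoped ComplexOrder Topology

variable {N : ℕ}

/-! ### Complete positivity -/

theorem isClosed_posSemidef (ι : Type) [Fintype ι] :
    IsClosed {M : Matrix ι ι ℂ | M.PosSemidef} := by
  have : {M : Matrix ι ι ℂ | M.PosSemidef} = {M | Mᴴ = M} ∩
      ⋂ x : ι → ℂ, {M | 0 ≤ star x ⬝ᵥ (M *ᵥ x)} := by
    ext M
    simp [posSemidef_iff_dotProduct_mulVec, IsHermitian]
  rw [this]
  refine (isClosed_eq continuous_id.matrix_conjTranspose continuous_id).inter
    (isClosed_iInter fun x => ?_)
  exact isClosed_le continuous_const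
    (continuous_const.dotProduct (continuous_id.matrix_mulVec continuous_const))

theorem isClosed_densityMatrices (ι : Type) [Fintype ι] : IsClosed (densityMatrices ι) :=
  (isClosed_posSemidef ι).inter (isClosed_eq continuous_id.matrix_trace continuous_const)

theorem continuous_ampliate (m : ℕ) (M : Matrix (Fin N × Fin m) (Fin N × Fin m) ℂ) :
    Continuous fun T : Op N => ampliate T m M :=
  continuous_matrix fun _ _ => (continuous_complexify _).matrix_elem _ _

theorem ampliate_one (m : ℕ) (M : Matrix (Fin N × Fin m) (Fin N × Fin m) ℂ) :
    ampliate (1 : Op N) m M = M := by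
  ext p q
  simp [ampliate, complexify_one]

theorem ampliate_mul (S T : Op N) (m : ℕ) (M : Matrix (Fin N × Fin m) (Fin N × Fin m) ℂ) :
    ampliate (S * T) m M = ampliate S m (ampliate T m M) := by
  ext p q
  simp only [ampliate, complexify_mul, of_apply]
  rfl

/-- The operators on `her(N)` all of whose ampliations are positive. -/
def completelyPositive (N : ℕ) : Submonoid (Op N) where
  carrier := {T | ∀ (m : ℕ) (M : Matrix (Fin N × Fin m) (Fin N × Fin m) ℂ),
    M.PosSemidef → (ampliate T m M).PosSemidef}
  one_mem' m M hM := by rwa [ampliate_one]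
  mul_mem' hS hT m M hM := by
    rw [ampliate_mul]
    exact hS m _ (hT m M hM)

theorem mem_completelyPositive {T : Op N} : T ∈ completelyPositive N ↔
    ∀ (m : ℕ) (M : Matrix (Fin N × Fin m) (Fin N × Fin m) ℂ),
      M.PosSemidef → (ampliate T m M).PosSemidef := Iff.rfl

theorem isClosed_completelyPositive : IsClosed (completelyPositive N : Set (Op N)) := by
  have : (completelyPositive N : Set (Op N)) =
      ⋂ (m : ℕ) (M : {M : Matrix (Fin N × Fin m) (Fin N × Fin m) ℂ // M.PosSemidef}),
        (fun T => ampliate T m M.1) ⁻¹' {M | M.PosSemidef} := by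
    ext T
    simp [mem_completelyPositive]
  rw [this]
  exact isClosed_iInter fun m => isClosed_iInter fun M =>
    (isClosed_posSemidef _).preimage (continuous_ampliate m M.1)

/-- The operators on `her(N)` that preserve the trace. -/
def tracePreserving (N : ℕ) : Submonoid (Op N) where
  carrier := {T | ∀ M, (complexify T M).trace = M.trace}
  one_mem' M := by rw [complexify_one]
  mul_mem' hS hT M := by rw [complexify_mul, hS, hT]

theorem mem_tracePreserving {T : Op N} :
    T ∈ tracePreserving N ↔ ∀ M, (complexify T M).trace = M.trace := Iff.rfl

theorem isClosed_tracePreserving : IsClosed (tracePreserving N : Set (Op N)) := by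
  have : (tracePreserving N : Set (Op N)) = ⋂ M, {T | (complexify T M).trace = M.trace} := by
    ext T
    simp [mem_tracePreserving]
  rw [this]
  exact isClosed_iInter fun M =>
    isClosed_eq (continuous_complexify M).matrix_trace continuous_const

/-- Kraus form implies complete positivity. -/
theorem mem_completelyPositive_of_kraus {T : Op N} {r : ℕ}
    (V : Fin r → Matrix (Fin N) (Fin N) ℂ)
    (h : ∀ M, complexify T M = ∑ k, V k * M * (V k)ᴴ) : T ∈ completelyPositive N := by
  intro m M hM
  have e : ampliate T m M = ∑ k, Matrix.kronecker (V k) (1 : Matrix (Fin m) (Fin m) ℂ) * M *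
      (Matrix.kronecker (V k) (1 : Matrix (Fin m) (Fin m) ℂ))ᴴ := by
    ext ⟨i, a⟩ ⟨j, b⟩
    simp only [ampliate, of_apply, h, Matrix.sum_apply]
    refine Finset.sum_congr rfl fun k _ => ?_
    simp [mul_apply, Fintype.sum_prod_type, one_apply, Finset.sum_mul, apply_ite]
  rw [e]
  exact posSemidef_sum _ fun k _ => hM.mul_mul_conjTranspose_same _

theorem trace_ampliate {T : Op N} (hT : T ∈ tracePreserving N) (m : ℕ)
    (M : Matrix (Fin N × Fin m) (Fin N × Fin m) ℂ) : (ampliate T m M).trace = M.trace := by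
  simp only [Matrix.trace, Fintype.sum_prod_type_right, Matrix.diag]
  refine Finset.sum_congr rfl fun a _ => ?_
  exact hT (Matrix.of fun i j => M (i, a) (j, a))

theorem mem_invertibleChannels_of_mem {T : GLHer N} (h1 : (T : Op N) ∈ completelyPositive N)
    (h2 : (T : Op N) ∈ tracePreserving N) : T ∈ invertibleChannels N := by
  refine ⟨fun ρ hρ => ⟨?_, ?_⟩, fun m M hM => ⟨h1 m M hM.1, by rw [trace_ampliate h2, hM.2]⟩⟩
  -- Positivity is the case `m = 1`, after identifying `Fin N × Fin 1` with `Fin N`.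
  · have h := h1 1 ((ρ : Matrix (Fin N) (Fin N) ℂ).submatrix Prod.fst Prod.fst)
      (hρ.1.submatrix _)
    have h' := h.submatrix fun i : Fin N => (i, (0 : Fin 1))
    rw [← complexify_coe]
    exact h'
  · rw [← complexify_coe, h2, hρ.2]

/-- Positive semidefinite matrices span all matrices. Each is zero or a multiple of a density
matrix, according to whether its trace vanishes. -/
theorem mem_tracePreserving_of_mem_invertibleChannels {T : GLHer N}
    (hT : T ∈ invertibleChannels N) : (T : Op N) ∈ tracePreserving N := by
  have key : traceLinearMap (Fin N) ℂ ℂ ∘ₗ complexifyₗ (T : Op N) = traceLinearMap (Fin N) ℂ ℂ := by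
    open scoped MatrixOrder in
    refine LinearMap.ext_on CStarAlgebra.span_nonneg fun M hM => ?_
    have hM : M.PosSemidef := nonneg_iff_posSemidef.mp hM
    simp only [LinearMap.comp_apply, traceLinearMap_apply]
    by_cases h0 : M.trace = 0
    · rw [hM.trace_eq_zero_iff.mp h0, map_zero]
    · have hd : M.trace⁻¹ • M ∈ densityMatrices (Fin N) := by
        refine ⟨hM.smul (inv_nonneg.mpr hM.trace_nonneg), ?_⟩
        rw [trace_smul, smul_eq_mul, inv_mul_cancel₀ h0]
      have h1 := (hT.1 ⟨M.trace⁻¹ • M, hd.1.isHermitian⟩ hd).2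
      rw [← complexify_coe, ← complexifyₗ_apply, map_smul, trace_smul, smul_eq_mul] at h1
      field_simp at h1
      exact h1
  exact fun M => LinearMap.congr_fun key M

/-- The Choi matrix of a channel is positive semidefinite. -/
theorem choi_posSemidef {T : GLHer N} (hT : T ∈ invertibleChannels N) :
    (choi (T : Op N)).PosSemidef := by
  rcases Nat.eq_zero_or_pos N with rfl | hN
  · rw [Subsingleton.elim (choi (T : Op 0)) 0]
    exact .zero
  have hN' : (N : ℂ) ≠ 0 := by exact_mod_cast hN.ne'
  -- The maximally entangled state: its image under `T ⊗ 1_N` is the Choi matrix divided by `N`.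
  -- Normalising it needs `N ≠ 0`.
  have hd : (N : ℂ)⁻¹ • vecMulVec (vecOne N) (star (vecOne N)) ∈
      densityMatrices (Fin N × Fin N) := by
    refine ⟨(posSemidef_vecMulVec_self_star _).smul (by positivity), ?_⟩
    have : (vecMulVec (vecOne N) (star (vecOne N))).trace = N := by
      simp [Matrix.trace, star_vecOne, vecOne, vecMulVec_apply, Fintype.sum_prod_type]
    rw [trace_smul, this, smul_eq_mul, inv_mul_cancel₀ hN']
  have h := (hT.2 N _ hd).1.smul (show (0 : ℂ) ≤ N by positivity)
  convert h using 1
  ext ⟨i, a⟩ ⟨j, b⟩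
  have e : (Matrix.of fun i j => ((N : ℂ)⁻¹ • vecMulVec (vecOne N) (star (vecOne N))) (i, a) (j, b))
      = (N : ℂ)⁻¹ • single a b (1 : ℂ) := by
    ext i j
    simp only [of_apply, Matrix.smul_apply, star_vecOne, vecMulVec_apply, vecOne, single_apply,
      eq_comm (a := a), eq_comm (a := b)]
    by_cases h1 : i = a <;> by_cases h2 : j = b <;> simp [h1, h2]
  change complexify (T : Op N) (single a b 1) i j = (N : ℂ) • complexify (T : Op N) (Matrix.of
    fun i j => ((N : ℂ)⁻¹ • vecMulVec (vecOne N) (star (vecOne N))) (i, a) (j, b)) i j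
  rw [e, ← complexifyₗ_apply, ← complexifyₗ_apply, map_smul, Matrix.smul_apply, smul_smul,
    mul_inv_cancel₀ hN', one_smul]

theorem choi_one : choi (1 : Op N) = vecMulVec (vecOne N) (vecOne N) := by
  ext ⟨i, a⟩ ⟨j, b⟩
  simp only [choi, of_apply, complexify_one, vecMulVec_apply, vecOne, single_apply]
  by_cases h1 : i = a <;> by_cases h2 : j = b <;> simp [h1, h2, eq_comm]

/-- The Choi matrix of the identity is the rank-one form along `vecOne N`, so subtracting it changes
nothing on the complement. This puts difference quotients of curves of channels into the cone. -/
theorem sub_one_mem_klGenerators {T : GLHer N} (hT : T ∈ invertibleChannels N) :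
    (T : Op N) - 1 ∈ klGenerators N := by
  have e : (T : Op N) - 1 = T + (-1 : ℝ) • 1 := by rw [neg_one_smul, sub_eq_add_neg]
  rw [e, mem_klGenerators_iff]
  refine ⟨fun M => ?_, fun x hx => ?_⟩
  · rw [complexify_add, complexify_smul, complexify_one, trace_add, trace_smul,
      mem_tracePreserving_of_mem_invertibleChannels hT]
    simp
  · rw [choi_add, choi_smul, choi_one, add_mulVec, smul_mulVec, vecMulVec_mulVec, hx,
      MulOpposite.op_zero, zero_smul, smul_zero, add_zero]
    exact (choi_posSemidef hT).dotProduct_mulVec_nonneg x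

/-! ### Exponentials of generators are channels -/

/-- The exponential of a Kossakowski–Lindblad generator is completely positive. -/
theorem exp_mem_completelyPositive {A : Op N} (hA : A ∈ klGenerators N) :
    NormedSpace.exp A ∈ completelyPositive N := by
  obtain ⟨r, V, G, -, h⟩ := complexify_eq_krausAdd_of_mem hA
  let Q : Op N := LinearMap.toContinuousLinearMap
    { toFun := fun ρ => ⟨G * (ρ : Matrix (Fin N) (Fin N) ℂ) * Gᴴ,
        isHermitian_mul_mul_conjTranspose G
          (show (ρ : Matrix (Fin N) (Fin N) ℂ).IsHermitian from ρ.2)⟩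
      map_add' := fun x y => Subtype.ext (by simp [mul_add, add_mul])
      map_smul' := fun c x => Subtype.ext (by simp) }
  have hQ (M : Matrix (Fin N) (Fin N) ℂ) : complexify Q M = G * M * Gᴴ :=
    complexify_eq_of_forall_her Q
      (LinearMap.mulRight ℂ Gᴴ ∘ₗ LinearMap.mulLeft ℂ G) (fun _ => rfl) M
  -- The curve `1 + t A` need not be completely positive. Adding `t² G M G†` completes the square to
  -- `(1 + t G) M (1 + t G)†`, which gives a Kraus form without changing the velocity at `0`.
  refine exp_mem_of_hasDerivWithinAt (completelyPositive N) isClosed_completelyPositive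
    (fun h : ℝ => 1 + h • A + (h ^ 2) • Q) A (fun t ht => ?_) (by simp) ?_
  · refine mem_completelyPositive_of_kraus
      (Fin.cons (1 + (t : ℂ) • G) fun k => (Real.sqrt t : ℂ) • V k) fun M => ?_
    have hs : (Real.sqrt t : ℂ) * (Real.sqrt t : ℂ) = t := by
      rw [← Complex.ofReal_mul, Real.mul_self_sqrt ht.le]
    rw [complexify_add, complexify_add, complexify_smul, complexify_smul, complexify_one, h, hQ,
      Fin.sum_univ_succ, krausAdd_apply]
    simp only [Fin.cons_zero, Fin.cons_succ, conjTranspose_smul, conjTranspose_add,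
      conjTranspose_one, RCLike.star_def, Complex.conj_ofReal, smul_mul_assoc, mul_smul_comm,
      smul_smul, hs, ← Finset.smul_sum, add_mul, mul_add, one_mul, mul_one, smul_add]
    push_cast
    rw [sq]
    abel
  · have h1 : HasDerivAt (fun h : ℝ => 1 + h • A + (h ^ 2) • Q)
        ((1 : ℝ) • A + ((2 : ℕ) * (0 : ℝ) ^ (2 - 1) * 1) • Q) 0 :=
      (((hasDerivAt_id (0 : ℝ)).smul_const A).const_add 1).add
        (((hasDerivAt_id (0 : ℝ)).pow 2).smul_const Q)
    simpa using h1.hasDerivWithinAt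

/-- The exponential of a Kossakowski–Lindblad generator preserves the trace. -/
theorem exp_mem_tracePreserving {A : Op N} (hA : A ∈ klGenerators N) :
    NormedSpace.exp A ∈ tracePreserving N := by
  refine exp_mem_of_hasDerivWithinAt (tracePreserving N) isClosed_tracePreserving
    (fun h : ℝ => 1 + h • A) A (fun t ht M => ?_) (by simp) ?_
  · rw [complexify_add, complexify_smul, complexify_one, trace_add, trace_smul,
      ((mem_klGenerators_iff A).mp hA).1, smul_zero, add_zero]
  · simpa using (((hasDerivAt_id (0 : ℝ)).smul_const A).const_add 1).hasDerivWithinAt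

/-- The exponential as an element of `GL(her(N))`. -/
def expUnit (A : Op N) : GLHer N where
  val := NormedSpace.exp A
  inv := NormedSpace.exp (-A)
  val_inv := exp_mul_exp_neg A
  inv_val := exp_neg_mul_exp A

theorem expUnit_mem_invertibleChannels {A : Op N} (hA : A ∈ klGenerators N) :
    expUnit A ∈ invertibleChannels N :=
  mem_invertibleChannels_of_mem (exp_mem_completelyPositive hA) (exp_mem_tracePreserving hA)

/-! ### The semigroup of invertible channels and its identity component -/

theorem one_mem_invertibleChannels : (1 : GLHer N) ∈ invertibleChannels N :=
  mem_invertibleChannels_of_mem (one_mem _) (one_mem _)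

theorem mul_mem_invertibleChannels {S T : GLHer N} (hS : S ∈ invertibleChannels N)
    (hT : T ∈ invertibleChannels N) : S * T ∈ invertibleChannels N := by
  refine ⟨fun ρ hρ => hS.1 _ (hT.1 ρ hρ), fun m M hM => ?_⟩
  rw [Units.val_mul, ampliate_mul]
  exact hS.2 m _ (hT.2 m M hM)

theorem isClosed_invertibleChannels : IsClosed (invertibleChannels N) := by
  have : invertibleChannels N =
      (⋂ ρ : {ρ : Her N // (ρ : Matrix (Fin N) (Fin N) ℂ) ∈ densityMatrices (Fin N)},
        {T : GLHer N | complexify (T : Op N) ρ.1 ∈ densityMatrices (Fin N)}) ∩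
      ⋂ (m : ℕ) (M : {M // M ∈ densityMatrices (Fin N × Fin m)}),
        {T : GLHer N | ampliate (T : Op N) m M.1 ∈ densityMatrices (Fin N × Fin m)} := by
    ext T
    simp only [invertibleChannels, positiveTP, IsCompletelyPositiveTP, complexify_coe,
      Set.mem_inter_iff, Set.mem_iInter, Subtype.forall, Set.mem_ofPred_eq]
  rw [this]
  refine (isClosed_iInter fun ρ => ?_).inter (isClosed_iInter fun m => isClosed_iInter fun M => ?_)
  · exact (isClosed_densityMatrices _).preimage
      ((continuous_complexify _).comp Units.continuous_val)
  · exact (isClosed_densityMatrices _).preimage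
      ((continuous_ampliate m M.1).comp Units.continuous_val)

theorem invertibleChannels₀_subset : invertibleChannels₀ N ⊆ invertibleChannels N :=
  connectedComponentIn_subset _ _

theorem one_mem_invertibleChannels₀ : (1 : GLHer N) ∈ invertibleChannels₀ N :=
  mem_connectedComponentIn one_mem_invertibleChannels

/-- The image of the connected set `P₀ × P₀` under multiplication is connected, contains the
identity and consists of channels. -/
theorem mul_mem_invertibleChannels₀ {S T : GLHer N} (hS : S ∈ invertibleChannels₀ N)
    (hT : T ∈ invertibleChannels₀ N) : S * T ∈ invertibleChannels₀ N := by
  have hc : IsPreconnected (invertibleChannels₀ N) := isPreconnected_connectedComponentIn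
  have h := (hc.prod hc).image (fun p : GLHer N × GLHer N => p.1 * p.2) continuous_mul.continuousOn
  refine h.subset_connectedComponentIn
    ⟨(1, 1), ⟨one_mem_invertibleChannels₀, one_mem_invertibleChannels₀⟩, one_mul 1⟩ ?_
    ⟨(S, T), ⟨hS, hT⟩, rfl⟩
  rintro _ ⟨p, hp, rfl⟩
  exact mul_mem_invertibleChannels (invertibleChannels₀_subset hp.1)
    (invertibleChannels₀_subset hp.2)

/-- The closure of the component is still connected and stays inside the closed set of channels. -/
theorem isClosed_invertibleChannels₀ : IsClosed (invertibleChannels₀ N) := by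
  refine isClosed_of_closure_subset ?_
  refine IsPreconnected.subset_connectedComponentIn
    (isPreconnected_connectedComponentIn.closure)
    (subset_closure one_mem_invertibleChannels₀) ?_
  exact closure_minimal invertibleChannels₀_subset isClosed_invertibleChannels

theorem continuous_expUnit_smul (A : Op N) : Continuous fun t : ℝ => expUnit (t • A) := by
  have h (B : Op N) : Continuous fun t : ℝ => NormedSpace.exp (t • B) :=
    continuous_iff_continuousAt.mpr fun t => (hasDerivAt_exp_smul B t).continuousAt
  refine Units.continuous_iff.mpr ⟨h A, ?_⟩
  have := h (-A)
  simp only [smul_neg] at this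
  exact this

theorem expUnit_mem_invertibleChannels₀ {A : Op N} (hA : A ∈ klGenerators N) :
    expUnit A ∈ invertibleChannels₀ N := by
  have h := (isPreconnected_Ici (a := (0 : ℝ))).image _ (continuous_expUnit_smul A).continuousOn
  refine h.subset_connectedComponentIn ⟨0, Set.self_mem_Ici, ?_⟩ ?_ ⟨1, ?_, ?_⟩
  · ext1
    simp [expUnit]
  · rintro _ ⟨t, ht, rfl⟩
    exact expUnit_mem_invertibleChannels (isWedge_klGenerators.smul_mem t ht A hA)
  · simp
  · simp only [one_smul]

/-! ### Tangent cones -/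

/-- The initial velocity of a curve of channels is a Kossakowski–Lindblad generator. -/
theorem mem_klGenerators_of_hasDerivWithinAt {f : ℝ → Op N} {g : Op N} (h0 : f 0 = 1)
    (hf : ∀ t, 0 < t → ∃ T ∈ invertibleChannels N, (T : Op N) = f t)
    (hd : HasDerivWithinAt f g (Set.Ici 0) 0) : g ∈ klGenerators N := by
  have h := hasDerivWithinAt_iff_tendsto_slope.mp hd
  rw [Set.Ici_sdiff_left] at h
  refine isWedge_klGenerators.isClosed.mem_of_tendsto h ?_
  filter_upwards [self_mem_nhdsWithin] with t ht
  obtain ⟨T, hT, hTf⟩ := hf t ht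
  rw [slope_def_module, h0, ← hTf, sub_zero]
  exact isWedge_klGenerators.smul_mem _ (inv_nonneg.mpr (le_of_lt ht)) _
    (sub_one_mem_klGenerators hT)

theorem tangentCone_subset_klGenerators {S : Set (GLHer N)} (hS : S ⊆ invertibleChannels N) :
    tangentCone S ⊆ klGenerators N := by
  rintro g ⟨γ, -, h0, hγ, hd⟩
  exact mem_klGenerators_of_hasDerivWithinAt (by rw [h0]; rfl)
    (fun t ht => ⟨γ t, hS (hγ t ht.le), rfl⟩) hd

theorem klGenerators_subset_tangentCone {S : Set (GLHer N)}
    (hS : ∀ A ∈ klGenerators N, expUnit A ∈ S) : klGenerators N ⊆ tangentCone S := by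
  intro A hA
  refine ⟨fun t => expUnit (t • A), ?_, ?_, fun t ht => ?_, ?_⟩
  · have h1 : ContDiff ℝ (⊤ : ℕ∞) (NormedSpace.exp : Op N → Op N) :=
      contDiff_iff_contDiffAt.mpr fun x => (NormedSpace.exp_analytic (𝕂 := ℝ) x).contDiffAt
    exact (h1.comp (contDiff_id.smul contDiff_const)).contDiffOn
  · ext1
    simp [expUnit]
  · exact hS _ (isWedge_klGenerators.smul_mem t ht A hA)
  · have h1 : HasDerivAt (fun t : ℝ => NormedSpace.exp (t • A)) A 0 := by
      simpa using hasDerivAt_exp_smul A 0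
    exact h1.hasDerivWithinAt

theorem tangentCone_invertibleChannels₀ :
    tangentCone (invertibleChannels₀ N) = klGenerators N :=
  (tangentCone_subset_klGenerators invertibleChannels₀_subset).antisymm
    (klGenerators_subset_tangentCone fun _ => expUnit_mem_invertibleChannels₀)

/-- Both `e^g` and `e^{-g}` are channels, so `e^g e^{th} e^{-g}` is a curve of channels, with the
conjugated operator as its initial velocity. -/
theorem conj_mem_klGenerators {g h : Op N} (hg : g ∈ klGenerators N) (hg' : -g ∈ klGenerators N)
    (hh : h ∈ klGenerators N) :
    NormedSpace.exp g * h * NormedSpace.exp (-g) ∈ klGenerators N := by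
  refine mem_klGenerators_of_hasDerivWithinAt
    (f := fun t : ℝ => NormedSpace.exp g * NormedSpace.exp (t • h) * NormedSpace.exp (-g))
    ?_ (fun t ht => ?_) ?_
  · simp [exp_mul_exp_neg]
  · exact ⟨expUnit g * expUnit (t • h) * expUnit (-g), mul_mem_invertibleChannels
      (mul_mem_invertibleChannels (expUnit_mem_invertibleChannels hg)
        (expUnit_mem_invertibleChannels (isWedge_klGenerators.smul_mem t ht.le h hh)))
      (expUnit_mem_invertibleChannels hg'), rfl⟩
  · have := ((hasDerivAt_exp_smul h 0).const_mul (NormedSpace.exp g)).mul_const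
      (NormedSpace.exp (-g))
    simpa using this.hasDerivWithinAt

theorem isLieWedge_klGenerators : IsLieWedge (klGenerators N) where
  toIsWedge := isWedge_klGenerators
  conj_edge g hg hg' := by
    refine Set.Subset.antisymm ?_ fun h hh => ?_
    · rintro _ ⟨h, hh, rfl⟩
      exact conj_mem_klGenerators hg hg' hh
    · refine ⟨_, conj_mem_klGenerators hg' (by rwa [neg_neg]) hh, ?_⟩
      simp only [neg_neg, ← mul_assoc, exp_mul_exp_neg, one_mul]
      rw [mul_assoc, exp_mul_exp_neg, mul_one]

/-! ### The Lie semigroup -/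

theorem lieSemigroupT_eq : lieSemigroupT N = closedSemigroupExp (klGenerators N) := by
  rw [lieSemigroupT, tangentCone_invertibleChannels₀]

theorem expUnit_mem_expSet {w : Set (Op N)} {A : Op N} (hA : A ∈ w) : expUnit A ∈ expSet w :=
  ⟨A, hA, rfl⟩

theorem expSet_eq_image (w : Set (Op N)) : expSet w = expUnit '' w := by
  ext T
  exact ⟨fun ⟨g, hg, h⟩ => ⟨g, hg, Units.ext h.symm⟩, fun ⟨g, hg, h⟩ => ⟨g, hg, by rw [← h]; rfl⟩⟩

theorem lieSemigroupT_subset : lieSemigroupT N ⊆ invertibleChannels₀ N := by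
  rw [lieSemigroupT_eq]
  refine closure_minimal ?_ isClosed_invertibleChannels₀
  let P : Submonoid (GLHer N) :=
    { carrier := invertibleChannels₀ N
      one_mem' := one_mem_invertibleChannels₀
      mul_mem' := mul_mem_invertibleChannels₀ }
  have : Submonoid.closure (expSet (klGenerators N)) ≤ P := by
    rw [Submonoid.closure_le, expSet_eq_image]
    rintro _ ⟨A, hA, rfl⟩
    exact expUnit_mem_invertibleChannels₀ hA
  exact this

theorem tangentCone_lieSemigroupT : tangentCone (lieSemigroupT N) = klGenerators N := by
  refine (tangentCone_subset_klGenerators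
    (lieSemigroupT_subset.trans invertibleChannels₀_subset)).antisymm
    (klGenerators_subset_tangentCone fun A hA => ?_)
  rw [lieSemigroupT_eq]
  exact subset_closure (Submonoid.subset_closure (expUnit_mem_expSet hA))

theorem isLieSubsemigroup_lieSemigroupT : IsLieSubsemigroup (lieSemigroupT N) where
  one_mem := subset_closure (one_mem (Submonoid.closure _))
  mul_mem A hA B hB :=
    (Submonoid.closure (expSet (tangentCone (invertibleChannels₀ N)))).topologicalClosure.mul_mem
      hA hB
  isClosed := isClosed_closure
  generated := by rw [tangentCone_lieSemigroupT, lieSemigroupT_eq]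

end MarkovLie

namespace MarkovLie

open Filter MeasureTheory
open scoped Topology

/-! ### Solutions of linear evolution equations are limits of products of exponentials -/

section Evolution

variable {R : Type*} [NormedRing R] [NormedAlgebra ℝ R] [CompleteSpace R]

/-- The integral of a function with values in a closed convex cone lies in the cone. -/
theorem intervalIntegral_mem_of_cone {K : Set R} (hK : IsClosed K) (hK0 : (0 : R) ∈ K)
    (hadd : ∀ g ∈ K, ∀ h ∈ K, g + h ∈ K) (hsmul : ∀ c : ℝ, 0 ≤ c → ∀ g ∈ K, c • g ∈ K)
    {f : ℝ → R} {a b : ℝ} (hab : a ≤ b) (hf : IntervalIntegrable f volume a b)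
    (hfK : ∀ t ∈ Set.Icc a b, f t ∈ K) : ∫ t in a..b, f t ∈ K := by
  rcases hab.eq_or_lt with rfl | hlt
  · rwa [intervalIntegral.integral_same]
  have hconv : Convex ℝ K := fun x hx y hy c d hc hd _ =>
    hadd _ (hsmul c hc x hx) _ (hsmul d hd y hy)
  have hae : ∀ᵐ t ∂volume.restrict (Set.uIoc a b), f t ∈ K := by
    refine (ae_restrict_iff' measurableSet_uIoc).mpr (Eventually.of_forall fun t ht => ?_)
    rw [Set.uIoc_of_le hab] at ht
    exact hfK t ⟨ht.1.le, ht.2⟩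
  -- The average lies in the closed convex set; the cone property then restores the factor `b - a`.
  have hm : (⨍ t in a..b, f t) ∈ K := by
    refine hconv.set_average_mem hK ?_ ?_ hae hf.def'
    · simp [Set.uIoc_of_le hab, hlt]
    · simp [Set.uIoc_of_le hab]
  rw [interval_average_eq] at hm
  have h := hsmul (b - a) (sub_nonneg.mpr hab) _ hm
  rwa [smul_smul, mul_inv_cancel₀ (sub_pos.mpr hlt).ne', one_smul] at h

/-- If `C` is a monoid that contains the exponentials of a closed convex cone `K`, then the
solutions of `X' = -L(t) X`, `X(0) = 1`, with `-L(t) ∈ K` take values in the closure of `C`. -/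
theorem mem_closure_of_evolution {K : Set R} (hK : IsClosed K) (hK0 : (0 : R) ∈ K)
    (hadd : ∀ g ∈ K, ∀ h ∈ K, g + h ∈ K) (hsmul : ∀ c : ℝ, 0 ≤ c → ∀ g ∈ K, c • g ∈ K)
    (C : Submonoid R) (hC : ∀ g ∈ K, NormedSpace.exp g ∈ C) {τ : ℝ} (hτ : 0 ≤ τ) {L X : ℝ → R}
    (hL : IntervalIntegrable L volume 0 τ) (hLK : ∀ t ∈ Set.Icc 0 τ, -L t ∈ K)
    (hX : ContinuousOn X (Set.Icc 0 τ))
    (hXL : ∀ t ∈ Set.Icc 0 τ, X t = 1 + ∫ s in (0 : ℝ)..t, -(L s * X s)) :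
    X τ ∈ closure (C : Set R) := by
  obtain ⟨M, hM⟩ := (isCompact_Icc (a := (0 : ℝ)) (b := τ)).exists_bound_of_continuousOn hX
  have hM0 : 0 ≤ M := (norm_nonneg _).trans (hM 0 ⟨le_rfl, hτ⟩)
  set Λ : ℝ := ∫ t in (0 : ℝ)..τ, ‖L t‖ with hΛ
  have hΛ0 : 0 ≤ Λ := intervalIntegral.integral_nonneg hτ fun _ _ => norm_nonneg _
  refine Metric.mem_closure_iff.mpr fun δ hδ => ?_
  set D : ℝ := (1 + M) * Λ * Real.exp (2 * Λ) with hD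
  have hD0 : 0 ≤ D := by positivity
  obtain ⟨ε, hε, hε1, hεD⟩ : ∃ ε : ℝ, 0 < ε ∧ ε ≤ 1 ∧ ε * D < δ := by
    refine ⟨min 1 (δ / (D + 1)), by positivity, min_le_left _ _, ?_⟩
    calc min 1 (δ / (D + 1)) * D ≤ δ / (D + 1) * D := by gcongr; exact min_le_right _ _
      _ < δ := by rw [div_mul_eq_mul_div, div_lt_iff₀ (by positivity)]; nlinarith
  obtain ⟨η, hη, hexp⟩ : ∃ η : ℝ, 0 < η ∧ ∀ B : R, ‖B‖ < η →
      ‖NormedSpace.exp B - 1 - B‖ ≤ ε * ‖B‖ := by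
    have h := (hasFDerivAt_iff_isLittleO.mp
      (hasFDerivAt_exp_zero (𝕂 := ℝ) (𝔸 := R))).def hε
    obtain ⟨η, hη, h⟩ := Metric.eventually_nhds_iff.mp h
    refine ⟨η, hη, fun B hB => ?_⟩
    have := h (y := B) (by rwa [dist_zero_right])
    simpa using this
  have hℓc : ContinuousOn (fun t => ∫ s in (0 : ℝ)..t, ‖L s‖) (Set.Icc 0 τ) := by
    have := intervalIntegral.continuousOn_primitive_interval' hL.norm
      (Set.left_mem_uIcc (a := (0 : ℝ)) (b := τ))
    rwa [Set.uIcc_of_le hτ] at this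
  -- The mesh has to control two things: the oscillation of `X`, and the integral of `‖L‖` over one
  -- step. The latter replaces a pointwise bound on `L`, which is only integrable.
  obtain ⟨d₁, hd₁, hX'⟩ := Metric.uniformContinuousOn_iff.mp
    (isCompact_Icc.uniformContinuousOn_of_continuous hX) ε hε
  obtain ⟨d₂, hd₂, hℓ'⟩ := Metric.uniformContinuousOn_iff.mp
    (isCompact_Icc.uniformContinuousOn_of_continuous hℓc) η hη
  obtain ⟨n, hn⟩ := exists_nat_gt (τ / min d₁ d₂)
  have hd : 0 < min d₁ d₂ := lt_min hd₁ hd₂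
  have hn0 : (0 : ℝ) < n := (div_nonneg hτ hd.le).trans_lt hn
  set h : ℝ := τ / n with hh
  have hh0 : 0 ≤ h := by positivity
  have hhd : h < min d₁ d₂ := by
    rw [hh, div_lt_iff₀ hn0]
    rwa [div_lt_iff₀ hd, mul_comm] at hn
  have hnh : (n : ℝ) * h = τ := by rw [hh]; field_simp
  set t : ℕ → ℝ := fun i => i * h with ht
  have ht0 : t 0 = 0 := by simp [ht]
  have htn : t n = τ := hnh
  have hts (i : ℕ) : t (i + 1) = t i + h := by simp only [ht]; push_cast; ring
  have htm {i : ℕ} (hi : i ≤ n) : t i ∈ Set.Icc 0 τ := by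
    refine ⟨by simp only [ht]; positivity, ?_⟩
    rw [← hnh]
    have : (i : ℝ) ≤ n := by exact_mod_cast hi
    simp only [ht]
    gcongr
  have hsub {i j : ℕ} (hi : i ≤ n) (hj : j ≤ n) : Set.uIcc (t i) (t j) ⊆ Set.uIcc 0 τ := by
    rw [Set.uIcc_of_le hτ]
    exact Set.uIcc_subset_Icc (htm hi) (htm hj)
  have hLi {i j : ℕ} (hi : i ≤ n) (hj : j ≤ n) : IntervalIntegrable L volume (t i) (t j) :=
    hL.mono_set (hsub hi hj)
  have hLX : IntervalIntegrable (fun s => -(L s * X s)) volume 0 τ :=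
    (hL.mul_continuousOn (by rwa [Set.uIcc_of_le hτ])).neg
  -- Integrating `-L` over the step, instead of sampling it, requires no regularity of `L` and keeps
  -- the exponent in the cone.
  set B : ℕ → R := fun i => ∫ s in t i..t (i + 1), -L s with hB
  set l : ℕ → ℝ := fun i => ∫ s in t i..t (i + 1), ‖L s‖ with hl
  have hle (i : ℕ) : t i ≤ t (i + 1) := by rw [hts]; linarith
  have hl0 (i : ℕ) : 0 ≤ l i := intervalIntegral.integral_nonneg (hle i) fun _ _ => norm_nonneg _
  have hBl (i : ℕ) : ‖B i‖ ≤ l i := by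
    refine (intervalIntegral.norm_integral_le_integral_norm (hle i)).trans (le_of_eq ?_)
    simp only [norm_neg, hl]
  have hlη {i : ℕ} (hi : i < n) : l i < η := by
    have h1 := hℓ' _ (htm (Nat.succ_le_of_lt hi)) _ (htm hi.le) (by
      rw [Nat.succ_eq_add_one, hts, Real.dist_eq, add_sub_cancel_left, abs_of_nonneg hh0]
      exact hhd.trans_le (min_le_right _ _))
    rw [Real.dist_eq, intervalIntegral.integral_interval_sub_left
      (by rw [← ht0]; exact (hLi (Nat.zero_le n) hi).norm)
      (by rw [← ht0]; exact (hLi (Nat.zero_le n) hi.le).norm)] at h1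
    exact (le_abs_self _).trans_lt h1
  have hexpB {i : ℕ} (hi : i < n) : ‖NormedSpace.exp (B i) - 1 - B i‖ ≤ ε * l i :=
    (hexp _ ((hBl i).trans_lt (hlη hi))).trans (by gcongr; exact hBl i)
  -- The error of a step has two parts: freezing `X` at `t i` costs `ε l i`, and the remainder `exp
  -- B - 1 - B` applied to `X` costs `ε l i M`.
  obtain ⟨Q, hQ, hQn⟩ := exists_mem_norm_sub_le C (fun i => X (t i))
    (fun i => NormedSpace.exp (B i)) l n (ε := ε * (1 + M)) (by positivity)
    (by simp only [ht0, hXL 0 ⟨le_rfl, hτ⟩, intervalIntegral.integral_same, add_zero])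
    (fun i _ => hl0 i)
    (fun i hi => hC _ (intervalIntegral_mem_of_cone hK hK0 hadd hsmul (hle i)
      (hLi hi.le hi).neg fun s hs => hLK s
        ⟨(htm hi.le).1.trans hs.1, hs.2.trans (htm (Nat.succ_le_of_lt hi)).2⟩))
    (fun i hi v => by
      have e : NormedSpace.exp (B i) * v =
          v + B i * v + (NormedSpace.exp (B i) - 1 - B i) * v := by noncomm_ring
      rw [e]
      have e1 := norm_mul_le_of_le (hBl i) (le_refl ‖v‖)
      have e2 := norm_mul_le_of_le (hexpB hi) (le_refl ‖v‖)
      have e3 := Real.add_one_le_exp (2 * l i)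
      have e4 : ε * l i * ‖v‖ ≤ 1 * l i * ‖v‖ := by
        have := hl0 i
        gcongr
      have e5 : (2 * l i + 1) * ‖v‖ ≤ Real.exp (2 * l i) * ‖v‖ := by gcongr
      refine (norm_add_le _ _).trans ((add_le_add_left (norm_add_le _ _) _).trans ?_)
      linarith)
    (fun i hi => by
      have hi' : i + 1 ≤ n := hi
      have e1 : X (t (i + 1)) - X (t i) = ∫ s in t i..t (i + 1), -(L s * X s) := by
        rw [hXL _ (htm hi'), hXL _ (htm hi.le), add_sub_add_left_eq_sub]
        refine intervalIntegral.integral_interval_sub_left (hLX.mono_set ?_) (hLX.mono_set ?_)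
        · rw [← ht0]; simpa only [ht0] using hsub (Nat.zero_le n) hi'
        · rw [← ht0]; simpa only [ht0] using hsub (Nat.zero_le n) hi.le
      have hLn : IntervalIntegrable (fun s => -L s) volume (t i) (t (i + 1)) :=
        (hLi hi.le hi').neg
      have e2 : B i * X (t i) = ∫ s in t i..t (i + 1), -L s * X (t i) :=
        ((((ContinuousLinearMap.mul ℝ R).flip (X (t i)))).intervalIntegral_comp_comm
          hLn).symm
      have e3 : X (t (i + 1)) - X (t i) - B i * X (t i) =
          ∫ s in t i..t (i + 1), -(L s * (X s - X (t i))) := by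
        rw [e1, e2, ← intervalIntegral.integral_sub (hLX.mono_set (hsub hi.le hi'))
          (hLn.mul_const _)]
        refine intervalIntegral.integral_congr fun s _ => ?_
        noncomm_ring
      have e4 : ‖X (t (i + 1)) - X (t i) - B i * X (t i)‖ ≤ ε * l i := by
        rw [e3, hl, ← intervalIntegral.integral_const_mul]
        refine intervalIntegral.norm_integral_le_of_norm_le (hle i)
          (Eventually.of_forall fun s hs => ?_) ((hLi hi.le hi').norm.const_mul ε)
        rw [norm_neg, mul_comm ε]
        refine norm_mul_le_of_le le_rfl ?_
        rw [← dist_eq_norm]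
        refine (hX' _ ⟨(htm hi.le).1.trans hs.1.le, hs.2.trans (htm hi').2⟩ _ (htm hi.le) ?_).le
        rw [Real.dist_eq, abs_of_nonneg (by linarith [hs.1])]
        have := hs.2
        rw [hts] at this
        linarith [hhd.trans_le (min_le_left d₁ d₂)]
      have e5 : X (t (i + 1)) - NormedSpace.exp (B i) * X (t i) =
          (X (t (i + 1)) - X (t i) - B i * X (t i)) -
            (NormedSpace.exp (B i) - 1 - B i) * X (t i) := by noncomm_ring
      rw [e5]
      refine (norm_sub_le _ _).trans ((add_le_add e4
        (norm_mul_le_of_le (hexpB hi) (hM _ (htm hi.le)))).trans (le_of_eq ?_))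
      ring)
  refine ⟨Q, hQ, ?_⟩
  have hsum : ∑ i ∈ Finset.range n, l i = Λ := by
    rw [hl, intervalIntegral.sum_integral_adjacent_intervals fun k hk => (hLi hk.le hk).norm,
      ht0, htn]
  rw [hsum, htn] at hQn
  rw [dist_comm, dist_eq_norm]
  calc ‖Q - X τ‖ ≤ ε * (1 + M) * Λ * Real.exp (2 * Λ) := hQn
    _ = ε * D := by rw [hD]; ring
    _ < δ := hεD

end Evolution
end MarkovLie

namespace MarkovLie

open Filter MeasureTheory
open scoped Topology

variable {N : ℕ}

/-! ### Markovian channels -/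

theorem continuousMarkovianChannels_subset :
    continuousMarkovianChannels N ⊆ markovianChannels N := by
  rintro T ⟨τ, L, X, hτ, hL, hLK, hX0, hX, hT⟩
  have hXc : ContinuousOn X (Set.Icc 0 τ) := fun t ht => (hX t ht).continuousWithinAt
  refine ⟨τ, L, X, hτ, hL.intervalIntegrable_of_Icc hτ, hLK, hXc, fun t ht => ?_, hT⟩
  have hsub : Set.Icc 0 t ⊆ Set.Icc 0 τ := Set.Icc_subset_Icc_right ht.2
  have h := intervalIntegral.integral_eq_sub_of_hasDerivAt_of_le ht.1 (hXc.mono hsub)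
    (fun s hs => (hX s (hsub ⟨hs.1.le, hs.2.le⟩)).hasDerivAt
      (Icc_mem_nhds hs.1 (hs.2.trans_le ht.2)))
    (((hL.mono hsub).mul (hXc.mono hsub)).neg.intervalIntegrable_of_Icc ht.1)
  rw [h, hX0]
  abel

/-- The evolution estimate takes place in the full operator algebra. The units carry the induced
topology, so closeness to products of exponentials there is closeness in the group. -/
theorem markovianChannels_subset_lieSemigroupT : markovianChannels N ⊆ lieSemigroupT N := by
  rintro T ⟨τ, L, X, hτ, hL, hLK, hX, hXL, hT⟩
  have hw := isWedge_klGenerators (N := N)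
  have h := mem_closure_of_evolution hw.isClosed hw.zero_mem hw.add_mem hw.smul_mem
    ((Submonoid.closure (expSet (klGenerators N))).map (Units.coeHom (Op N)))
    (fun g hg => ⟨expUnit g, Submonoid.subset_closure (expUnit_mem_expSet hg), rfl⟩)
    hτ hL hLK hX hXL
  rw [hT] at h
  rw [lieSemigroupT_eq, closedSemigroupExp,
    Units.isOpenEmbedding_val.isInducing.closure_eq_preimage_closure_image]
  exact h

/-- Products of exponentials of Kossakowski–Lindblad generators are reached by continuous
evolutions: each factor is switched on and off smoothly. -/
theorem exists_evolution_of_mem_closure {T : GLHer N}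
    (hT : T ∈ Submonoid.closure (expSet (klGenerators N))) :
    ∃ (τ : ℝ) (L X : ℝ → Op N), 0 ≤ τ ∧ Continuous L ∧ (∀ t, -L t ∈ klGenerators N) ∧ X 0 = 1 ∧
      (∀ t, HasDerivAt X (-(L t * X t)) t) ∧ (∀ t, τ ≤ t → L t = 0) ∧
      ∀ t, τ ≤ t → X t = (T : Op N) := by
  -- Left multiplication matches time order: the new factor acts last. Requiring `L = 0` and `X`
  -- constant from time `τ` on makes it possible to append a factor after `τ`.
  induction hT using Submonoid.closure_induction_left with
  | one =>
    refine ⟨0, 0, 1, le_rfl, continuous_const, fun t => ?_, rfl, fun t => ?_, fun _ _ => rfl,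
      fun _ _ => rfl⟩
    · simpa using isWedge_klGenerators.zero_mem
    · simpa using! hasDerivAt_const t (1 : Op N)
  | mul_left S hS T _ ih =>
    obtain ⟨g, hg, hSg⟩ := hS
    obtain ⟨τ, L, X, hτ, hL, hLK, hX0, hX, hLτ, hXτ⟩ := ih
    have hd : Differentiable ℝ Real.smoothTransition :=
      (Real.smoothTransition.contDiff (n := 1)).differentiable one_ne_zero
    have hdc : Continuous (deriv Real.smoothTransition) :=
      (Real.smoothTransition.contDiff (n := 1)).continuous_deriv le_rfl
    have hd0 (u : ℝ) : 0 ≤ deriv Real.smoothTransition u :=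
      Real.smoothTransition.monotone.deriv_nonneg
    -- The transition function attains its maximum `1` at such `u`, so its derivative vanishes even
    -- at the endpoint `u = 1`.
    have hd1 {u : ℝ} (hu : 1 ≤ u) : deriv Real.smoothTransition u = 0 := by
      refine IsLocalMax.deriv_eq_zero (Eventually.of_forall fun v => ?_)
      rw [Real.smoothTransition.one_of_one_le hu]
      exact Real.smoothTransition.le_one v
    refine ⟨τ + 1, fun t => L t - deriv Real.smoothTransition (t - τ) • g,
      fun t => NormedSpace.exp (Real.smoothTransition (t - τ) • g) * X t, by linarith, ?_, ?_, ?_,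
      fun t => ?_, fun t ht => ?_, fun t ht => ?_⟩
    · exact hL.sub ((hdc.comp (continuous_id.sub continuous_const)).smul continuous_const)
    · intro t
      rw [neg_sub, sub_eq_add_neg]
      exact isWedge_klGenerators.add_mem _ (isWedge_klGenerators.smul_mem _ (hd0 _) g hg) _ (hLK t)
    · simp only [hX0, mul_one]
      rw [Real.smoothTransition.zero_of_nonpos (by linarith), zero_smul, NormedSpace.exp_zero]
    · have h1 : HasDerivAt (fun t => Real.smoothTransition (t - τ))
          (deriv Real.smoothTransition (t - τ)) t :=
        (hd (t - τ)).hasDerivAt.comp_sub_const t τ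
      have h2 := (hasDerivAt_exp_smul g (Real.smoothTransition (t - τ))).scomp t h1
      have h3 := h2.mul (hX t)
      refine h3.congr_deriv ?_
      -- `g` and `L t` need not commute, but at every time one of the two factors is trivial: the
      -- exponential is `1` before `τ`, and `L` vanishes after it.
      have h4 : NormedSpace.exp (Real.smoothTransition (t - τ) • g) * (L t * X t) =
          L t * (NormedSpace.exp (Real.smoothTransition (t - τ) • g) * X t) := by
        rcases le_total t τ with h | h
        · rw [Real.smoothTransition.zero_of_nonpos (by linarith), zero_smul, NormedSpace.exp_zero,
            one_mul, one_mul]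
        · rw [hLτ t h, zero_mul, zero_mul, mul_zero]
      simp only [Function.comp_apply]
      rw [mul_neg, h4, sub_mul, smul_mul_assoc, smul_mul_assoc, mul_assoc]
      abel
    · simp only
      rw [hLτ t (by linarith), hd1 (by linarith), zero_smul, sub_zero]
    · simp only
      rw [hXτ t (by linarith), Real.smoothTransition.one_of_one_le (by linarith), one_smul,
        Units.val_mul, hSg]

theorem closure_expSet_subset_continuousMarkovianChannels :
    (Submonoid.closure (expSet (klGenerators N)) : Set (GLHer N)) ⊆
      continuousMarkovianChannels N := by
  intro T hT
  obtain ⟨τ, L, X, hτ, hL, hLK, hX0, hX, -, hXτ⟩ := exists_evolution_of_mem_closure hT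
  exact ⟨τ, L, X, hτ, hL.continuousOn, fun t _ => hLK t, hX0,
    fun t _ => (hX t).hasDerivWithinAt, hXτ τ le_rfl⟩

theorem lieSemigroupT_subset_closure :
    lieSemigroupT N ⊆ closure (continuousMarkovianChannels N) := by
  rw [lieSemigroupT_eq]
  exact closure_mono closure_expSet_subset_continuousMarkovianChannels

theorem closure_markovianChannels_subset : closure (markovianChannels N) ⊆ lieSemigroupT N :=
  closure_minimal markovianChannels_subset_lieSemigroupT isClosed_closure

end MarkovLie

end

theorem mainTheorem1 (N : ℕ) :
    closure (MarkovLie.markovianChannels N) = MarkovLie.lieSemigroupT N ∧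
    closure (MarkovLie.continuousMarkovianChannels N) = MarkovLie.lieSemigroupT N ∧
    MarkovLie.IsLieSubsemigroup (MarkovLie.lieSemigroupT N) ∧
    MarkovLie.lieSemigroupT N ⊆ MarkovLie.invertibleChannels₀ N ∧
    MarkovLie.tangentCone (MarkovLie.lieSemigroupT N) =
      MarkovLie.tangentCone (MarkovLie.invertibleChannels₀ N) ∧
    MarkovLie.tangentCone (MarkovLie.invertibleChannels₀ N) = MarkovLie.klGenerators N ∧
    MarkovLie.IsLieWedge (MarkovLie.tangentCone (MarkovLie.invertibleChannels₀ N)) := by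
  have hsub := closure_mono (MarkovLie.continuousMarkovianChannels_subset (N := N))
  refine ⟨MarkovLie.closure_markovianChannels_subset.antisymm
      (MarkovLie.lieSemigroupT_subset_closure.trans hsub),
    (hsub.trans MarkovLie.closure_markovianChannels_subset).antisymm
      MarkovLie.lieSemigroupT_subset_closure,
    MarkovLie.isLieSubsemigroup_lieSemigroupT, MarkovLie.lieSemigroupT_subset, ?_,
    MarkovLie.tangentCone_invertibleChannels₀, ?_⟩
  · rw [MarkovLie.tangentCone_lieSemigroupT, MarkovLie.tangentCone_invertibleChannels₀]
  · rw [MarkovLie.tangentCone_invertibleChannels₀]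
    exact MarkovLie.isLieWedge_klGenerators
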